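/- Let $d\ge 0$ be an integer and let $P\subseteq\mathbb{R}^d$ be a closed convex cone (containing $0$) that is spanning, $P-P=\mathbb{R}^d$, and pointed, $P\cap(-P)=\{0\}$. Inner products are antilinear in the first variable. For a complex Hilbert space $H$, an $E_0$-semigroup over $P$ on $B(H)$ is a family $\alpha=\{\alpha_x\}_{x\in P}$ of unital normal $*$-endomorphisms of $B(H)$ with $\alpha_0=\mathrm{id}$, $\alpha_x\circ\alpha_y=\alpha_{x+y}$ for $x,y\in P$, and $x\mapsto\rho(\alpha_x(T))$ continuous on $P$ for every $T\in B(H)$ and every $\rho$ in the predual of $B(H)$. It extends to an automorphism group if there is a family $\{\beta_x\}_{x\in\mathbb{R}^d}$ of $*$-automorphisms of $B(H)$ with $\beta_0=\mathrm{id}$, $\beta_{x+y}=\beta_x\circ\beta_y$ for all $x,y\in\mathbb{R}^d$, and $\beta_x=\alpha_x$ for all $x\in P$. For a unitary $U:H\to K$ write $\mathrm{Ad}(U)(T)=UTU^*$. An $\alpha$-cocycle is a strongly continuous family $\{W_x\}_{x\in P}$ of unitaries on $H$ with $W_x\alpha_x(W_y)=W_{x+y}$ for all $x,y\in P$. An $E_0$-semigroup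 $\alpha$ on $B(H)$ is cocycle conjugate to an $E_0$-semigroup $\beta$ on $B(K)$ if there are a unitary $U:H\to K$ and a $\beta$-cocycle $\{W_x\}_{x\in P}$ such that $\mathrm{Ad}(U)\circ\alpha_x\circ\mathrm{Ad}(U)^{-1}=\mathrm{Ad}(W_x)\circ\beta_x$ for all $x\in P$. This is an equivalence relation. Let $B_0(d)$ be the set of strictly upper triangular real $d\times d$ matrices. For $A\in B_0(d)$ and $x,y\in\mathbb{R}^d$ put $\omega_A(x,y)=e^{i\langle Ax,y\rangle}$, and for $x\in P$ let $U^A_x$ be the unitary operator on $L^2(\mathbb{R}^d)$ given by $$(U^A_xf)(y)=\omega_A(x,y-x)\,f(y-x)\qquad\text{for almost every }y\in\mathbb{R}^d .$$ Put $\alpha^A_x=\mathrm{Ad}(U^A_x)$. Then $\alpha^A=\{\alpha^A_x\}_{x\in P}$ is an $E_0$-semigroup over $P$ on $B(L^2(\mathbb{R}^d))$ that extends to an automorphism group. Let $\mathfrak{E}$ be the set of cocycle conjugacy classes of $E_0$-semigroups over $P$ on $B(L^2(\mathbb{R}^d))$ that extend to an automorphism group. Then the map $B_0(d)\ni A\mapsto[\alpha^A]\in\mathfrak{E}$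 is a bijection. -/

import Mathlib

open MeasureTheory Filter Topology
open scoped InnerProductSpace ENNReal

noncomputable section

namespace ConeE0

/-! ### E₀-semigroups on `B(H)` and cocycle conjugacy -/

section Abstract

variable {S : Type*} [AddCommMonoid S] [TopologicalSpace S]
variable {H : Type*} [NormedAddCommGroup H] [InnerProductSpace ℂ H] [CompleteSpace H]
variable {K : Type*} [NormedAddCommGroup K] [InnerProductSpace ℂ K] [CompleteSpace K]
variable {L : Type*} [NormedAddCommGroup L] [InnerProductSpace ℂ L] [CompleteSpace L]

/-- `ρ` belongs to the predual of `B(H)`: it is of the form `T ↦ ∑ₙ ⟪ξₙ, T ηₙ⟫` for two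
square-summable sequences of vectors (equivalently `T ↦ tr (R T)` with `R` of trace class). -/
def IsNormalFunctional (ρ : (H →L[ℂ] H) → ℂ) : Prop :=
  ∃ ξ η : ℕ → H, (Summable fun n => ‖ξ n‖ ^ 2) ∧ (Summable fun n => ‖η n‖ ^ 2) ∧
    ∀ T : H →L[ℂ] H, ρ T = ∑' n, ⟪ξ n, T (η n)⟫_ℂ

/-- A map `B(H) → B(H)` is normal (that is, `σ`-weakly continuous) if it pulls back elements of the
predual to elements of the predual. -/
def IsNormalMap (φ : (H →L[ℂ] H) → (H →L[ℂ] H)) : Prop :=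
  ∀ ρ : (H →L[ℂ] H) → ℂ, IsNormalFunctional ρ → IsNormalFunctional fun T => ρ (φ T)

variable (S H) in
/-- An `E₀`-semigroup over `S` on `B(H)`: a `σ`-weakly continuous semigroup of unital normal
`*`-endomorphisms of `B(H)` indexed by `S`. -/
structure E0Semigroup where
  /-- the endomorphism attached to an index -/
  toFun : S → ((H →L[ℂ] H) →⋆ₐ[ℂ] (H →L[ℂ] H))
  normal' : ∀ x, IsNormalMap (toFun x)
  map_zero' : toFun 0 = StarAlgHom.id ℂ (H →L[ℂ] H)
  map_add' : ∀ x y, toFun (x + y) = (toFun x).comp (toFun y)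
  continuous' : ∀ ρ : (H →L[ℂ] H) → ℂ, IsNormalFunctional ρ → ∀ T : H →L[ℂ] H,
    Continuous fun x => ρ (toFun x T)

/-- `W` is an `α`-cocycle: a strongly continuous family of unitaries with
`W x * α x (W y) = W (x + y)`. -/
structure IsCocycle (α : E0Semigroup S H) (W : S → unitary (H →L[ℂ] H)) : Prop where
  continuous : ∀ ξ : H, Continuous fun x => (W x : H →L[ℂ] H) ξ
  mul : ∀ x y, (W x : H →L[ℂ] H) * α.toFun x (W y : H →L[ℂ] H) = (W (x + y) : H →L[ℂ] H)

/-- `α` (on `B(H)`) is cocycle conjugate to `β` (on `B(K)`): for some unitary `U : H → K` the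
`E₀`-semigroup `Ad U ∘ αₓ ∘ (Ad U)⁻¹` is a cocycle perturbation `Ad (W x) ∘ βₓ` of `β`. -/
def CocycleConjugate (α : E0Semigroup S H) (β : E0Semigroup S K) : Prop :=
  ∃ (U : H ≃ₗᵢ[ℂ] K) (W : S → unitary (K →L[ℂ] K)), IsCocycle β W ∧
    ∀ (x : S) (T : K →L[ℂ] K),
      U.conjStarAlgEquiv (α.toFun x (U.conjStarAlgEquiv.symm T)) =
        Unitary.conjStarAlgAut ℂ (K →L[ℂ] K) (W x) (β.toFun x T)

/-- Applying a strongly continuous family of unitaries to a continuous family of vectors. -/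
theorem continuous_unitary_apply {X : Type*} [TopologicalSpace X]
    {W : X → unitary (H →L[ℂ] H)} (hW : ∀ ξ : H, Continuous fun x => (W x : H →L[ℂ] H) ξ)
    {g : X → H} (hg : Continuous g) : Continuous fun x => (W x : H →L[ℂ] H) (g x) := by
  rw [continuous_iff_continuousAt]
  intro x₀
  have h1 : Tendsto (fun x => (W x : H →L[ℂ] H) (g x₀)) (𝓝 x₀) (𝓝 ((W x₀ : H →L[ℂ] H) (g x₀))) :=
    (hW (g x₀)).tendsto x₀
  have h2 : Tendsto (fun x => (W x : H →L[ℂ] H) (g x - g x₀)) (𝓝 x₀) (𝓝 0) := by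
    rw [tendsto_zero_iff_norm_tendsto_zero]
    have h3 : Tendsto (fun x => ‖g x - g x₀‖) (𝓝 x₀) (𝓝 0) := by
      have := (hg.tendsto x₀).sub_const (g x₀)
      rw [sub_self] at this
      simpa using this.norm
    refine h3.congr fun x => ?_
    rw [ContinuousLinearMap.norm_map_of_mem_unitary (W x).2]
  have h4 := h1.add h2
  rw [add_zero] at h4
  refine h4.congr fun x => ?_
  rw [← map_add, add_sub_cancel]

theorem unitary_apply_star_apply (W : unitary (H →L[ℂ] H)) (ξ : H) :
    (W : H →L[ℂ] H) ((star (W : H →L[ℂ] H)) ξ) = ξ := by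
  have := Unitary.mul_star_self_of_mem W.2
  calc _ = ((W : H →L[ℂ] H) * star (W : H →L[ℂ] H)) ξ := rfl
    _ = ξ := by rw [this]; rfl

theorem unitary_star_apply_apply (W : unitary (H →L[ℂ] H)) (ξ : H) :
    (star (W : H →L[ℂ] H)) ((W : H →L[ℂ] H) ξ) = ξ := by
  have := Unitary.star_mul_self_of_mem W.2
  calc _ = (star (W : H →L[ℂ] H) * (W : H →L[ℂ] H)) ξ := rfl
    _ = ξ := by rw [this]; rfl

/-- The adjoints of a strongly continuous family of unitaries are strongly continuous. -/
theorem continuous_unitary_star {X : Type*} [TopologicalSpace X]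
    {W : X → unitary (H →L[ℂ] H)} (hW : ∀ ξ : H, Continuous fun x => (W x : H →L[ℂ] H) ξ)
    (ξ : H) : Continuous fun x => (star (W x : H →L[ℂ] H)) ξ := by
  rw [continuous_iff_continuousAt]
  intro x₀
  rw [ContinuousAt, tendsto_iff_norm_sub_tendsto_zero]
  set η := (star (W x₀ : H →L[ℂ] H)) ξ with hη
  have h1 : Tendsto (fun x => ‖(W x : H →L[ℂ] H) η - (W x₀ : H →L[ℂ] H) η‖) (𝓝 x₀) (𝓝 0) :=
    tendsto_iff_norm_sub_tendsto_zero.1 ((hW η).tendsto x₀)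
  refine h1.congr fun x => ?_
  have h2 : (W x₀ : H →L[ℂ] H) η = ξ := unitary_apply_star_apply _ _
  rw [h2, norm_sub_rev, ← ContinuousLinearMap.norm_map_of_mem_unitary (W x).2 (_ - η), map_sub,
    unitary_apply_star_apply]

/-- `Ad U` of a unitary, as an element of the unitary group. -/
def conjUnitary (U : H ≃ₗᵢ[ℂ] K) (W : unitary (H →L[ℂ] H)) : unitary (K →L[ℂ] K) :=
  ⟨U.conjStarAlgEquiv W, by
    rw [Unitary.mem_iff, ← map_star, ← map_mul, ← map_mul, Unitary.star_mul_self_of_mem W.2,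
      Unitary.mul_star_self_of_mem W.2, map_one]
    exact ⟨rfl, rfl⟩⟩

theorem coe_conjUnitary (U : H ≃ₗᵢ[ℂ] K) (W : unitary (H →L[ℂ] H)) :
    (conjUnitary U W : K →L[ℂ] K) = U.conjStarAlgEquiv (W : H →L[ℂ] H) := rfl

theorem CocycleConjugate.refl (α : E0Semigroup S H) : CocycleConjugate α α := by
  refine ⟨LinearIsometryEquiv.refl ℂ H, fun _ => 1, ⟨fun ξ => continuous_const, fun x y => ?_⟩,
    fun x T => ?_⟩
  · simp
  · simp

theorem CocycleConjugate.symm {α : E0Semigroup S H} {β : E0Semigroup S K}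
    (h : CocycleConjugate α β) : CocycleConjugate β α := by
  obtain ⟨U, W, hW, h⟩ := h
  have key : ∀ x (T : H →L[ℂ] H), U.conjStarAlgEquiv (α.toFun x T) =
      (W x : K →L[ℂ] K) * β.toFun x (U.conjStarAlgEquiv T) * star (W x : K →L[ℂ] K) := by
    intro x T
    have := h x (U.conjStarAlgEquiv T)
    rwa [StarAlgEquiv.symm_apply_apply, Unitary.conjStarAlgAut_apply] at this
  refine ⟨U.symm, fun x => conjUnitary U.symm (star (W x)), ⟨fun ξ => ?_, fun x y => ?_⟩,
    fun x T => ?_⟩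
  · have := U.symm.continuous.comp (continuous_unitary_star hW.continuous (U ξ))
    exact this
  · apply EquivLike.injective U.conjStarAlgEquiv
    rw [map_mul, key]
    simp only [coe_conjUnitary, ← LinearIsometryEquiv.symm_conjStarAlgEquiv,
      StarAlgEquiv.apply_symm_apply, Unitary.coe_star]
    rw [← hW.mul x y, star_mul, map_star, ← mul_assoc, ← mul_assoc,
      Unitary.star_mul_self_of_mem (W x).2, one_mul]
  · apply EquivLike.injective U.conjStarAlgEquiv
    rw [Unitary.conjStarAlgAut_apply, map_mul, map_mul, map_star, key]
    simp only [coe_conjUnitary, ← LinearIsometryEquiv.symm_conjStarAlgEquiv,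
      StarAlgEquiv.apply_symm_apply, Unitary.coe_star, star_star]
    rw [show U.conjStarAlgEquiv.symm.symm T = U.conjStarAlgEquiv T from rfl]
    simp only [mul_assoc]
    rw [Unitary.star_mul_self_of_mem (W x).2, mul_one, ← mul_assoc,
      Unitary.star_mul_self_of_mem (W x).2, one_mul]

theorem CocycleConjugate.trans {α : E0Semigroup S H} {β : E0Semigroup S K} {γ : E0Semigroup S L}
    (h₁ : CocycleConjugate α β) (h₂ : CocycleConjugate β γ) : CocycleConjugate α γ := by
  obtain ⟨U, W, hW, h₁⟩ := h₁
  obtain ⟨V, Z, hZ, h₂⟩ := h₂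
  have key : ∀ x (T : K →L[ℂ] K), V.conjStarAlgEquiv (β.toFun x T) =
      (Z x : L →L[ℂ] L) * γ.toFun x (V.conjStarAlgEquiv T) * star (Z x : L →L[ℂ] L) := by
    intro x T
    have := h₂ x (V.conjStarAlgEquiv T)
    rwa [StarAlgEquiv.symm_apply_apply, Unitary.conjStarAlgAut_apply] at this
  refine ⟨U.trans V, fun x => conjUnitary V (W x) * Z x, ⟨fun ξ => ?_, fun x y => ?_⟩,
    fun x T => ?_⟩
  · have h1 : Continuous fun x => V.symm ((Z x : L →L[ℂ] L) ξ) :=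
      V.symm.continuous.comp (hZ.continuous ξ)
    exact V.continuous.comp (continuous_unitary_apply hW.continuous h1)
  · simp only [Submonoid.coe_mul, coe_conjUnitary, map_mul]
    rw [← hW.mul x y, map_mul, key, ← hZ.mul x y]
    simp only [mul_assoc]
    rw [← mul_assoc (star (Z x : L →L[ℂ] L)), Unitary.star_mul_self_of_mem (Z x).2, one_mul]
  · rw [LinearIsometryEquiv.conjStarAlgEquiv_trans]
    have e1 := congrArg V.conjStarAlgEquiv (h₁ x (V.conjStarAlgEquiv.symm T))
    rw [Unitary.conjStarAlgAut_apply, map_mul, map_mul, map_star, key,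
      StarAlgEquiv.apply_symm_apply] at e1
    rw [Unitary.conjStarAlgAut_apply]
    simp only [Submonoid.coe_mul, coe_conjUnitary, star_mul, mul_assoc] at e1 ⊢
    exact e1

variable (S H) in
/-- Cocycle conjugacy as an equivalence relation on the `E₀`-semigroups on `B(H)`. -/
def cocycleSetoid : Setoid (E0Semigroup S H) where
  r := CocycleConjugate
  iseqv := ⟨CocycleConjugate.refl, CocycleConjugate.symm, CocycleConjugate.trans⟩

/-- The terms of a normal functional are summable. -/
theorem summable_mul_norm {H : Type*} [NormedAddCommGroup H] {ξ η : ℕ → H} (hξ : Summable fun n => ‖ξ n‖ ^ 2)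
    (hη : Summable fun n => ‖η n‖ ^ 2) : Summable fun n => ‖ξ n‖ * ‖η n‖ := by
  refine Summable.of_nonneg_of_le (fun n => by positivity) (fun n => ?_) (hξ.add hη)
  nlinarith [sq_nonneg (‖ξ n‖ - ‖η n‖), sq_nonneg (‖ξ n‖), sq_nonneg (‖η n‖)]

/-- Conjugation by a unitary is normal. -/
theorem isNormalMap_conj (W : unitary (H →L[ℂ] H)) :
    IsNormalMap (Unitary.conjStarAlgAut ℂ (H →L[ℂ] H) W) := by
  rintro ρ ⟨ξ, η, hξ, hη, hρ⟩
  have hn : ∀ v : H, ‖(star (W : H →L[ℂ] H)) v‖ = ‖v‖ := fun v =>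
    ContinuousLinearMap.norm_map_of_mem_unitary (star W).2 v
  refine ⟨fun n => (star (W : H →L[ℂ] H)) (ξ n), fun n => (star (W : H →L[ℂ] H)) (η n), ?_, ?_,
    fun T => ?_⟩
  · simpa only [hn] using hξ
  · simpa only [hn] using hη
  · refine (hρ _).trans ?_
    refine tsum_congr fun n => ?_
    rw [ContinuousLinearMap.star_eq_adjoint, ContinuousLinearMap.adjoint_inner_left]
    rfl

/-- Conjugation by a strongly continuous family of unitaries is `σ`-weakly continuous. -/
theorem continuous_conj {X : Type*} [TopologicalSpace X]
    {W : X → unitary (H →L[ℂ] H)} (hW : ∀ ξ : H, Continuous fun x => (W x : H →L[ℂ] H) ξ)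
    {ρ : (H →L[ℂ] H) → ℂ} (hρ : IsNormalFunctional ρ) (T : H →L[ℂ] H) :
    Continuous fun x => ρ (Unitary.conjStarAlgAut ℂ (H →L[ℂ] H) (W x) T) := by
  obtain ⟨ξ, η, hξ, hη, hρ⟩ := hρ
  have hn : ∀ x (v : H), ‖(star (W x : H →L[ℂ] H)) v‖ = ‖v‖ := fun x v =>
    ContinuousLinearMap.norm_map_of_mem_unitary (star (W x)).2 v
  simp only [hρ]
  refine continuous_tsum (u := fun n => ‖T‖ * (‖ξ n‖ * ‖η n‖)) (fun n => ?_)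
    ((summable_mul_norm hξ hη).mul_left _) (fun n x => ?_)
  · exact continuous_const.inner (continuous_unitary_apply hW
      (T.continuous.comp (continuous_unitary_star hW (η n))))
  · refine (norm_inner_le_norm _ _).trans ?_
    have h1 : ‖(Unitary.conjStarAlgAut ℂ (H →L[ℂ] H) (W x) T) (η n)‖ ≤ ‖T‖ * ‖η n‖ := by
      calc _ = ‖(W x : H →L[ℂ] H) (T ((star (W x : H →L[ℂ] H)) (η n)))‖ := rfl
        _ = ‖T ((star (W x : H →L[ℂ] H)) (η n))‖ :=
          ContinuousLinearMap.norm_map_of_mem_unitary (W x).2 _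
        _ ≤ ‖T‖ * ‖(star (W x : H →L[ℂ] H)) (η n)‖ := T.le_opNorm _
        _ = _ := by rw [hn]
    calc _ ≤ ‖ξ n‖ * (‖T‖ * ‖η n‖) := by gcongr
      _ = _ := by ring

end Abstract

/-! ### Twisted translations on `L²(ℝᵈ)` -/

/-- `d`-dimensional Euclidean space. -/
abbrev E (d : ℕ) : Type := EuclideanSpace ℝ (Fin d)

/-- The Hilbert space `L²(ℝᵈ)` of complex-valued functions, for Lebesgue measure. -/
abbrev L2 (d : ℕ) : Type := Lp ℂ 2 (volume : Measure (E d))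

/-- The real `d × d` matrices that are strictly upper triangular. -/
def StrictUpper (d : ℕ) : Type :=
  {A : Matrix (Fin d) (Fin d) ℝ // ∀ i j, j ≤ i → A i j = 0}

variable {d : ℕ}

/-- The multiplier `ω_A(x, y) = exp(i⟨Ax, y⟩)`. -/
def omega (A : StrictUpper d) (x y : E d) : ℂ :=
  Complex.exp (Complex.I * ((⟪Matrix.toEuclideanLin A.1 x, y⟫_ℝ : ℝ) : ℂ))

theorem norm_omega (A : StrictUpper d) (x y : E d) : ‖omega A x y‖ = 1 := by
  rw [omega, mul_comm, Complex.norm_exp_ofReal_mul_I]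

theorem omega_zero_left (A : StrictUpper d) (y : E d) : omega A 0 y = 1 := by
  simp [omega]

theorem omega_add_left (A : StrictUpper d) (x x' y : E d) :
    omega A (x + x') y = omega A x y * omega A x' y := by
  rw [omega, omega, omega, ← Complex.exp_add, map_add, inner_add_left]
  push_cast
  ring_nf

theorem omega_add_right (A : StrictUpper d) (x y y' : E d) :
    omega A x (y + y') = omega A x y * omega A x y' := by
  rw [omega, omega, omega, ← Complex.exp_add, inner_add_right]
  push_cast
  ring_nf

theorem continuous_omega (A : StrictUpper d) {X : Type*} [TopologicalSpace X] {f g : X → E d}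
    (hf : Continuous f) (hg : Continuous g) : Continuous fun p => omega A (f p) (g p) := by
  have h1 : Continuous fun p => Matrix.toEuclideanLin A.1 (f p) :=
    (LinearMap.continuous_of_finiteDimensional (Matrix.toEuclideanLin A.1)).comp hf
  have h2 : Continuous fun p => ⟪Matrix.toEuclideanLin A.1 (f p), g p⟫_ℝ := h1.inner hg
  exact Complex.continuous_exp.comp (continuous_const.mul (Complex.continuous_ofReal.comp h2))

theorem continuous_omega_sub (A : StrictUpper d) (x : E d) :
    Continuous fun y : E d => omega A x (y - x) :=
  continuous_omega A continuous_const (continuous_id.sub continuous_const)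

theorem memLp_mulUnimod {c : E d → ℂ} (hc : Continuous c) (h1 : ∀ y, ‖c y‖ = 1) (f : L2 d) :
    MemLp (fun y => c y * f y) 2 (volume : Measure (E d)) :=
  MemLp.of_le (Lp.memLp f) (hc.aestronglyMeasurable.mul (Lp.aestronglyMeasurable f))
    (ae_of_all _ fun y => by
      rw [norm_mul, h1, one_mul])

/-- Multiplication of an `L²` function by a continuous function of modulus one. -/
def mulUnimod (c : E d → ℂ) (hc : Continuous c) (h1 : ∀ y, ‖c y‖ = 1) : L2 d →ₗᵢ[ℂ] L2 d where
  toFun f := (memLp_mulUnimod hc h1 f).toLp _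
  map_add' f g := by
    apply Lp.ext
    filter_upwards [Lp.coeFn_add f g, (memLp_mulUnimod hc h1 f).coeFn_toLp,
      (memLp_mulUnimod hc h1 g).coeFn_toLp, (memLp_mulUnimod hc h1 (f + g)).coeFn_toLp,
      Lp.coeFn_add ((memLp_mulUnimod hc h1 f).toLp _) ((memLp_mulUnimod hc h1 g).toLp _)]
      with y e1 e2 e3 e4 e5
    rw [e4, e5, Pi.add_apply, e2, e3, e1, Pi.add_apply, mul_add]
  map_smul' a f := by
    apply Lp.ext
    filter_upwards [Lp.coeFn_smul a f, (memLp_mulUnimod hc h1 f).coeFn_toLp,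
      (memLp_mulUnimod hc h1 (a • f)).coeFn_toLp,
      Lp.coeFn_smul a ((memLp_mulUnimod hc h1 f).toLp _)] with y e1 e2 e3 e4
    rw [e3, RingHom.id_apply, e4, Pi.smul_apply, e2, e1, Pi.smul_apply, smul_eq_mul, smul_eq_mul]
    ring
  norm_map' f := by
    refine le_antisymm (Lp.norm_le_norm_of_ae_le ?_) (Lp.norm_le_norm_of_ae_le ?_)
    all_goals
      filter_upwards [(memLp_mulUnimod hc h1 f).coeFn_toLp] with y e
      simp only [LinearMap.coe_mk, AddHom.coe_mk]
      rw [e, norm_mul, h1, one_mul]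

theorem mulUnimod_coeFn (c : E d → ℂ) (hc : Continuous c) (h1 : ∀ y, ‖c y‖ = 1) (f : L2 d) :
    mulUnimod c hc h1 f =ᵐ[volume] fun y => c y * f y :=
  (memLp_mulUnimod hc h1 f).coeFn_toLp

/-- The translate `y ↦ f (y - x)`. -/
def translate (x : E d) : L2 d →ₗᵢ[ℂ] L2 d :=
  Lp.compMeasurePreservingₗᵢ ℂ (fun y => y - x) (measurePreserving_sub_right volume x)

theorem translate_coeFn (x : E d) (f : L2 d) :
    translate x f =ᵐ[volume] fun y => f (y - x) :=
  Lp.coeFn_compMeasurePreserving f (measurePreserving_sub_right volume x)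

/-- The twisted translation `(U f)(y) = ω_A(x, y - x) f (y - x)`, as an isometry. -/
def twistedIsometry (A : StrictUpper d) (x : E d) : L2 d →ₗᵢ[ℂ] L2 d :=
  (mulUnimod (fun y => omega A x (y - x))
    (continuous_omega_sub A x)
    (fun _ => norm_omega A _ _)).comp (translate x)

theorem twistedIsometry_coeFn (A : StrictUpper d) (x : E d) (f : L2 d) :
    twistedIsometry A x f =ᵐ[volume] fun y => omega A x (y - x) * f (y - x) := by
  filter_upwards [mulUnimod_coeFn (fun y => omega A x (y - x))
    (continuous_omega_sub A x)
    (fun _ => norm_omega A _ _) (translate x f), translate_coeFn x f] with y e1 e2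
  exact e1.trans (by rw [e2])

theorem twistedIsometry_comp (A : StrictUpper d) (x x' : E d) (f : L2 d) :
    twistedIsometry A x (twistedIsometry A x' f) =
      omega A x x' • twistedIsometry A (x + x') f := by
  apply Lp.ext
  have h := (measurePreserving_sub_right (volume : Measure (E d)) x).quasiMeasurePreserving.ae
    (twistedIsometry_coeFn A x' f)
  filter_upwards [twistedIsometry_coeFn A x (twistedIsometry A x' f), h,
    twistedIsometry_coeFn A (x + x') f,
    Lp.coeFn_smul (omega A x x') (twistedIsometry A (x + x') f)] with y e1 e2 e3 e4
  rw [e1, e2, e4, Pi.smul_apply, e3, smul_eq_mul, omega_add_left, sub_sub]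
  have : y - x = x' + (y - (x + x')) := by abel
  rw [this, omega_add_right]
  ring

theorem twistedIsometry_zero (A : StrictUpper d) (f : L2 d) : twistedIsometry A 0 f = f := by
  apply Lp.ext
  filter_upwards [twistedIsometry_coeFn A 0 f] with y e
  rw [e, omega_zero_left, one_mul, sub_zero]

theorem twistedIsometry_surjective (A : StrictUpper d) (x : E d) :
    Function.Surjective (twistedIsometry A x) := by
  intro f
  have hne : omega A x (-x) ≠ 0 := by
    rw [← norm_pos_iff, norm_omega]; exact one_pos
  refine ⟨(omega A x (-x))⁻¹ • twistedIsometry A (-x) f, ?_⟩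
  rw [map_smul, twistedIsometry_comp, add_neg_cancel, twistedIsometry_zero, smul_smul,
    inv_mul_cancel₀ hne, one_smul]

/-- The unitary `U^A_x` on `L²(ℝᵈ)`, `(U^A_x f)(y) = ω_A(x, y - x) f (y - x)`. -/
def twistedTranslation (A : StrictUpper d) (x : E d) : unitary (L2 d →L[ℂ] L2 d) :=
  Unitary.linearIsometryEquiv.symm
    (LinearIsometryEquiv.ofSurjective (twistedIsometry A x) (twistedIsometry_surjective A x))

theorem twistedTranslation_apply (A : StrictUpper d) (x : E d) (f : L2 d) :
    (twistedTranslation A x : L2 d →L[ℂ] L2 d) f = twistedIsometry A x f := rfl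

/-- The defining formula `(U^A_x f)(y) = ω_A(x, y - x) f (y - x)` for almost every `y`. -/
theorem twistedTranslation_coeFn (A : StrictUpper d) (x : E d) (f : L2 d) :
    (twistedTranslation A x : L2 d →L[ℂ] L2 d) f =ᵐ[volume]
      fun y => omega A x (y - x) * f (y - x) :=
  twistedIsometry_coeFn A x f

theorem twistedTranslation_mul (A : StrictUpper d) (x y : E d) :
    (twistedTranslation A x : L2 d →L[ℂ] L2 d) * (twistedTranslation A y : L2 d →L[ℂ] L2 d) =
      omega A x y • (twistedTranslation A (x + y) : L2 d →L[ℂ] L2 d) :=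
  ContinuousLinearMap.ext fun f => twistedIsometry_comp A x y f

theorem twistedTranslation_zero (A : StrictUpper d) : twistedTranslation A 0 = 1 :=
  Subtype.ext (ContinuousLinearMap.ext fun f => twistedIsometry_zero A f)

theorem continuous_translate (f : L2 d) : Continuous fun x : E d => translate x f :=
  Continuous.compMeasurePreservingLp (f := fun _ : E d => f)
    (g := fun x : E d => (⟨fun y => y - x, by fun_prop⟩ : C(E d, E d))) continuous_const
    (ContinuousMap.continuous_of_continuous_uncurry _ (by
      simp only [Function.uncurry_def, ContinuousMap.coe_mk]; fun_prop))
    (fun x => measurePreserving_sub_right volume x) (by simp)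

theorem continuous_twistedTranslation (A : StrictUpper d) (f : L2 d) :
    Continuous fun x : E d => (twistedTranslation A x : L2 d →L[ℂ] L2 d) f := by
  have hc : ∀ x : E d, Continuous fun y : E d => omega A x (y - x) := continuous_omega_sub A
  let M : E d → L2 d →ₗᵢ[ℂ] L2 d := fun x =>
    mulUnimod (fun y => omega A x (y - x)) (hc x) (fun _ => norm_omega A _ _)
  rw [continuous_iff_continuousAt]
  intro x₀
  set g : L2 d := translate x₀ f with hg
  have hin : ∀ x, ⟪M x₀ g, M x g⟫_ℂ =
      ∫ y, ⟪omega A x₀ (y - x₀) * g y, omega A x (y - x) * g y⟫_ℂ := by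
    intro x
    rw [L2.inner_def]
    refine integral_congr_ae ?_
    filter_upwards [mulUnimod_coeFn (fun y => omega A x (y - x)) (hc x)
      (fun _ => norm_omega A _ _) g, mulUnimod_coeFn (fun y => omega A x₀ (y - x₀)) (hc x₀)
      (fun _ => norm_omega A _ _) g] with y e1 e2
    rw [e1, e2]
  have hcont : Continuous fun x => ⟪M x₀ g, M x g⟫_ℂ := by
    simp only [hin]
    refine continuous_of_dominated (bound := fun y => ‖g y‖ ^ 2) (fun x => ?_) (fun x => ?_) ?_ ?_
    · exact ((hc x₀).aestronglyMeasurable.mul (Lp.aestronglyMeasurable g)).inner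
        ((hc x).aestronglyMeasurable.mul (Lp.aestronglyMeasurable g))
    · refine ae_of_all _ fun y => (norm_inner_le_norm _ _).trans ?_
      rw [norm_mul, norm_mul, norm_omega, norm_omega, one_mul, sq]
    · exact (memLp_two_iff_integrable_sq_norm (Lp.aestronglyMeasurable g)).1 (Lp.memLp g)
    · refine ae_of_all _ fun y => continuous_const.inner (Continuous.mul ?_ continuous_const)
      exact continuous_omega A continuous_id (continuous_const.sub continuous_id)
  have hsq : ∀ x, ‖M x g - M x₀ g‖ ^ 2 = 2 * ‖g‖ ^ 2 - 2 * (⟪M x₀ g, M x g⟫_ℂ).re := by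
    intro x
    rw [norm_sub_sq (𝕜 := ℂ), ← inner_conj_symm, (M x).norm_map, (M x₀).norm_map]
    simp only [RCLike.re_to_complex, Complex.conj_re]
    ring
  have h1 : Tendsto (fun x => ‖M x g - M x₀ g‖) (𝓝 x₀) (𝓝 0) := by
    have h2 : Continuous fun x => ‖M x g - M x₀ g‖ ^ 2 := by
      simp only [hsq]
      fun_prop
    have h3 : Continuous fun x => ‖M x g - M x₀ g‖ := by
      have := h2.sqrt
      simpa only [Real.sqrt_sq (norm_nonneg _)] using this
    simpa using h3.tendsto x₀
  have h4 : Tendsto (fun x => ‖translate x f - g‖) (𝓝 x₀) (𝓝 0) :=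
    tendsto_iff_norm_sub_tendsto_zero.1 ((continuous_translate f).tendsto x₀)
  rw [ContinuousAt, tendsto_iff_norm_sub_tendsto_zero]
  refine squeeze_zero (fun _ => norm_nonneg _) (fun x => ?_) (by simpa using h4.add h1)
  calc ‖(twistedTranslation A x : L2 d →L[ℂ] L2 d) f - (twistedTranslation A x₀ : L2 d →L[ℂ] L2 d) f‖
      = ‖M x (translate x f - g) + (M x g - M x₀ g)‖ := by
        rw [map_sub, sub_add_sub_cancel]; rfl
    _ ≤ ‖translate x f - g‖ + ‖M x g - M x₀ g‖ := by
        refine (norm_add_le _ _).trans ?_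
        rw [LinearIsometry.norm_map]

/-- The automorphism group `x ↦ Ad (U^A_x)` of `B(L²(ℝᵈ))`, indexed by `ℝᵈ`. -/
def twistedAut (A : StrictUpper d) (x : E d) : (L2 d →L[ℂ] L2 d) ≃⋆ₐ[ℂ] (L2 d →L[ℂ] L2 d) :=
  Unitary.conjStarAlgAut ℂ (L2 d →L[ℂ] L2 d) (twistedTranslation A x)

theorem twistedAut_zero (A : StrictUpper d) (T : L2 d →L[ℂ] L2 d) : twistedAut A 0 T = T := by
  rw [twistedAut, twistedTranslation_zero, map_one]; rfl

theorem twistedAut_add (A : StrictUpper d) (x y : E d) (T : L2 d →L[ℂ] L2 d) :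
    twistedAut A (x + y) T = twistedAut A x (twistedAut A y T) := by
  have h := twistedTranslation_mul A x y
  have hw : omega A x y * star (omega A x y) = 1 := by
    rw [Complex.star_def, Complex.mul_conj, Complex.normSq_eq_norm_sq, norm_omega]; simp
  simp only [twistedAut, Unitary.conjStarAlgAut_apply]
  calc _ = (omega A x y • (twistedTranslation A (x + y) : L2 d →L[ℂ] L2 d)) * T *
        star (omega A x y • (twistedTranslation A (x + y) : L2 d →L[ℂ] L2 d)) := by
        rw [star_smul, smul_mul_assoc, smul_mul_assoc, mul_smul_comm, smul_smul, hw, one_smul]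
    _ = _ := by
        rw [← h, star_mul]
        simp only [mul_assoc]

/-! ### Semigroups over a cone, and the classification map -/

/-- The `E₀`-semigroup `α^A = (Ad (U^A_x))_{x ∈ P}` on `B(L²(ℝᵈ))` over the cone `P`. -/
def twistedE0 (P : PointedCone ℝ (E d)) (A : StrictUpper d) : E0Semigroup P (L2 d) where
  toFun x := (twistedAut A (x : E d) : (L2 d →L[ℂ] L2 d) →⋆ₐ[ℂ] (L2 d →L[ℂ] L2 d))
  normal' x := isNormalMap_conj (twistedTranslation A (x : E d))
  map_zero' := StarAlgHom.ext fun T => twistedAut_zero A T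
  map_add' x y := StarAlgHom.ext fun T => twistedAut_add A x y T
  continuous' _ hρ T := continuous_conj (W := fun x : P => twistedTranslation A (x : E d))
    (fun f => (continuous_twistedTranslation A f).comp continuous_subtype_val) hρ T

/-- `α` extends to an automorphism group, that is, to a homomorphism from the additive group `ℝᵈ`
to the group of `*`-automorphisms of `B(H)`. For a cone `P` that spans `ℝᵈ` the extension is unique,
and it inherits `σ`-weak continuity from `α`, so that requiring continuity of it would not change
the notion. -/
def ExtendsToAutGroup {P : PointedCone ℝ (E d)} {H : Type*} [NormedAddCommGroup H]
    [InnerProductSpace ℂ H] [CompleteSpace H] (α : E0Semigroup P H) : Prop :=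
  ∃ β : E d → ((H →L[ℂ] H) ≃⋆ₐ[ℂ] (H →L[ℂ] H)),
    (∀ T, β 0 T = T) ∧ (∀ x y T, β (x + y) T = β x (β y T)) ∧
      ∀ (x : P) (T : H →L[ℂ] H), α.toFun x T = β (x : E d) T

theorem twistedE0_extends (P : PointedCone ℝ (E d)) (A : StrictUpper d) :
    ExtendsToAutGroup (twistedE0 P A) :=
  ⟨twistedAut A, twistedAut_zero A, twistedAut_add A, fun _ _ => rfl⟩

/-- The `E₀`-semigroups over `P` on `B(L²(ℝᵈ))` that extend to an automorphism group. -/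
abbrev ExtendableE0 (P : PointedCone ℝ (E d)) : Type :=
  {α : E0Semigroup P (L2 d) // ExtendsToAutGroup α}

/-- Cocycle conjugacy on the extendable `E₀`-semigroups. -/
def extendableSetoid (P : PointedCone ℝ (E d)) : Setoid (ExtendableE0 P) :=
  (cocycleSetoid P (L2 d)).comap Subtype.val

/-- The set of cocycle conjugacy classes of extendable `E₀`-semigroups on `B(L²(ℝᵈ))`. -/
def ExtendableClasses (P : PointedCone ℝ (E d)) : Type := Quotient (extendableSetoid P)

/-- The class `[α^A]`. -/
def twistedClass (P : PointedCone ℝ (E d)) (A : StrictUpper d) : ExtendableClasses P :=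
  Quotient.mk (extendableSetoid P) ⟨twistedE0 P A, twistedE0_extends P A⟩

end ConeE0

end

/-! Every `*`-automorphism of `B(H)` is `Ad u` for a unitary `u`, unique up to a phase
(`exists_unitary_conj`, `exists_scalarUnitary_mul`). An automorphism group over ℝᵈ is therefore a
projective unitary representation, and its invariant is the commutator of the implementing
unitaries, which no choice of phases affects. For `α^A` this commutator is the exponential of i(⟨Ax,
y⟩ - ⟨Ay, x⟩), and an antisymmetric form comes from exactly one strictly upper triangular matrix.

Injectivity: a cocycle conjugacy yields two families of unitaries that implement the same
automorphisms, one with the multiplier of `A` and one with that of `B`, so the commutators agree on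
`P × P`. Rescaling one argument inside the cone removes the ambiguity modulo 2π
(`antisymm_eq_of_cocycleConjugate`), and `P - P = ℝᵈ` extends the equality to all vectors.

Surjectivity: `P` contains a basis, and along it the extension is weakly continuous. Each
one-parameter group of automorphisms lifts to a one-parameter group of unitaries
(`exists_oneParameterUnitary`): a continuous multiplier on ℝ is trivialized near 0 by integration,
and the resulting local homomorphism extends to ℝ by taking powers. These unitary groups commute up
to bicharacters exp(ibst), so their product has multiplier exp(iB(x, y)) with `B` bilinear
(`exists_projective_representation`). The symmetric part of `B` is a coboundary, so a change of
phases gives the multiplier of some `A`. Two projective representations on the same space with equal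
multipliers differ by a cocycle (`cocycleConjugate_of_multiplier`). -/

noncomputable section

namespace ConeE0

/-! ### Phases of unitaries and strong continuity of families -/

section Scalars

variable {H : Type*} [NormedAddCommGroup H] [InnerProductSpace ℂ H] [CompleteSpace H]

variable (H) in
/-- The scalar unitary operators on a Hilbert space. -/
def scalarUnitary : Circle →* unitary (H →L[ℂ] H) where
  toFun c := ⟨(c : ℂ) • (1 : H →L[ℂ] H), by
    have h : star (c : ℂ) * (c : ℂ) = 1 := by
      rw [Complex.star_def, ← Complex.normSq_eq_conj_mul_self, Circle.normSq_coe,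
        Complex.ofReal_one]
    rw [Unitary.mem_iff, star_smul, star_one, smul_mul_smul_comm, smul_mul_smul_comm, one_mul,
      mul_comm (c : ℂ), h, one_smul]
    exact ⟨rfl, rfl⟩⟩
  map_one' := Subtype.ext (by simp)
  map_mul' a b := Subtype.ext (by
    have h : ((a * b : Circle) : ℂ) • (1 : H →L[ℂ] H) =
        ((a : ℂ) • (1 : H →L[ℂ] H)) * ((b : ℂ) • (1 : H →L[ℂ] H)) := by
      rw [smul_mul_smul_comm, one_mul, Circle.coe_mul]
    exact h)

theorem coe_scalarUnitary (c : Circle) :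
    (scalarUnitary H c : H →L[ℂ] H) = (c : ℂ) • (1 : H →L[ℂ] H) := rfl

theorem scalarUnitary_apply (c : Circle) (ξ : H) :
    (scalarUnitary H c : H →L[ℂ] H) ξ = (c : ℂ) • ξ := rfl

theorem mul_apply' (u v : unitary (H →L[ℂ] H)) (ξ : H) :
    ((u * v : unitary (H →L[ℂ] H)) : H →L[ℂ] H) ξ = (u : H →L[ℂ] H) ((v : H →L[ℂ] H) ξ) := rfl

theorem scalarUnitary_mul_comm (c : Circle) (u : unitary (H →L[ℂ] H)) :
    u * scalarUnitary H c = scalarUnitary H c * u :=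
  Subtype.ext (by
    rw [Submonoid.coe_mul, Submonoid.coe_mul, coe_scalarUnitary, mul_smul_comm, smul_mul_assoc,
      mul_one, one_mul])

theorem scalarUnitary_left_comm (c : Circle) (u v : unitary (H →L[ℂ] H)) :
    u * (scalarUnitary H c * v) = scalarUnitary H c * (u * v) := by
  rw [← mul_assoc, scalarUnitary_mul_comm, mul_assoc]

theorem scalarUnitary_injective [Nontrivial H] : Function.Injective (scalarUnitary H) := by
  intro a b h
  obtain ⟨ξ, hξ⟩ := exists_ne (0 : H)
  have h1 : (a : ℂ) • ξ = (b : ℂ) • ξ := by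
    rw [← scalarUnitary_apply, ← scalarUnitary_apply, h]
  exact Subtype.ext (smul_left_injective ℂ hξ h1)

theorem conj_scalarUnitary (c : Circle) :
    Unitary.conjStarAlgAut ℂ (H →L[ℂ] H) (scalarUnitary H c) = 1 := by
  ext1 T
  have h : (scalarUnitary H c : H →L[ℂ] H) * T = T * (scalarUnitary H c : H →L[ℂ] H) := by
    rw [coe_scalarUnitary, mul_smul_comm, smul_mul_assoc, mul_one, one_mul]
  rw [Unitary.conjStarAlgAut_apply, h, mul_assoc,
    Unitary.mul_star_self_of_mem (scalarUnitary H c).2, mul_one]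
  rfl

/-- Two unitaries inducing the same automorphism of `B(H)` differ by a scalar. -/
theorem exists_scalarUnitary_mul {u v : unitary (H →L[ℂ] H)}
    (h : Unitary.conjStarAlgAut ℂ (H →L[ℂ] H) u = Unitary.conjStarAlgAut ℂ (H →L[ℂ] H) v) :
    ∃ c : Circle, u = scalarUnitary H c * v := by
  obtain ⟨α, hα⟩ := (Unitary.conjStarAlgAut_ext_iff' u v).1 h
  have hn : ‖(α : ℂ)‖ = 1 := CStarRing.norm_of_mem_unitary α.2
  obtain ⟨c, hc⟩ : ∃ c : Circle, (c : ℂ) = α := ⟨⟨α, mem_sphere_zero_iff_norm.2 hn⟩, rfl⟩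
  refine ⟨c, Subtype.ext ?_⟩
  rw [Submonoid.coe_mul, coe_scalarUnitary, smul_mul_assoc, one_mul, hα, hc]
  rfl

/-- Every `*`-automorphism of `B(H)` is implemented by a unitary. -/
theorem exists_unitary_conj (f : (H →L[ℂ] H) ≃⋆ₐ[ℂ] (H →L[ℂ] H)) :
    ∃ u : unitary (H →L[ℂ] H), f = Unitary.conjStarAlgAut ℂ (H →L[ℂ] H) u := by
  obtain ⟨U, hU⟩ := StarAlgEquiv.eq_linearIsometryEquivConjStarAlgEquiv f (map_continuous f)
  exact ⟨Unitary.linearIsometryEquiv.symm U, by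
    rw [hU, Unitary.conjStarAlgAut_symm_unitaryLinearIsometryEquiv]⟩

variable {X : Type*} [TopologicalSpace X] {x₀ : X}

theorem continuousAt_unitary_mul {F G : X → unitary (H →L[ℂ] H)}
    (hF : ∀ ξ : H, ContinuousAt (fun x => (F x : H →L[ℂ] H) ξ) x₀)
    (hG : ∀ ξ : H, ContinuousAt (fun x => (G x : H →L[ℂ] H) ξ) x₀) (ξ : H) :
    ContinuousAt (fun x => ((F x * G x : unitary (H →L[ℂ] H)) : H →L[ℂ] H) ξ) x₀ := by
  have h1 := hF ((G x₀ : H →L[ℂ] H) ξ)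
  have h2 := hG ξ
  rw [ContinuousAt, tendsto_iff_norm_sub_tendsto_zero] at h1 h2 ⊢
  refine squeeze_zero (fun _ => norm_nonneg _) (fun x => ?_) (by simpa using h2.add h1)
  calc _ = ‖(F x : H →L[ℂ] H) ((G x : H →L[ℂ] H) ξ - (G x₀ : H →L[ℂ] H) ξ) +
        ((F x : H →L[ℂ] H) ((G x₀ : H →L[ℂ] H) ξ) -
          (F x₀ : H →L[ℂ] H) ((G x₀ : H →L[ℂ] H) ξ))‖ := by
        rw [map_sub, sub_add_sub_cancel]; rfl
    _ ≤ _ := (norm_add_le _ _).trans (by rw [Unitary.norm_map])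

theorem continuous_unitary_mul {F G : X → unitary (H →L[ℂ] H)}
    (hF : ∀ ξ : H, Continuous fun x => (F x : H →L[ℂ] H) ξ)
    (hG : ∀ ξ : H, Continuous fun x => (G x : H →L[ℂ] H) ξ) (ξ : H) :
    Continuous fun x => ((F x * G x : unitary (H →L[ℂ] H)) : H →L[ℂ] H) ξ :=
  continuous_unitary_apply hF (hG ξ)

theorem continuousAt_scalarUnitary {c : X → Circle} (hc : ContinuousAt c x₀) (ξ : H) :
    ContinuousAt (fun x => (scalarUnitary H (c x) : H →L[ℂ] H) ξ) x₀ :=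
  (continuous_subtype_val.continuousAt.comp hc).smul continuousAt_const

theorem continuous_scalarUnitary {c : X → Circle} (hc : Continuous c) (ξ : H) :
    Continuous fun x => (scalarUnitary H (c x) : H →L[ℂ] H) ξ :=
  continuous_iff_continuousAt.2 fun _ => continuousAt_scalarUnitary hc.continuousAt ξ

/-- The scalar relating two strongly continuous families of unitaries is continuous. -/
theorem continuousAt_of_eq_scalarUnitary_mul [Nontrivial H] {F G : X → unitary (H →L[ℂ] H)}
    (hF : ∀ ξ : H, ContinuousAt (fun x => (F x : H →L[ℂ] H) ξ) x₀)
    (hG : ∀ ξ : H, ContinuousAt (fun x => (G x : H →L[ℂ] H) ξ) x₀) {c : X → Circle}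
    (h : ∀ x, F x = scalarUnitary H (c x) * G x) : ContinuousAt c x₀ := by
  obtain ⟨ξ, hξ⟩ := exists_norm_eq (E := H) zero_le_one
  refine (Topology.IsInducing.continuousAt_iff (g := ((↑) : Circle → ℂ)) ⟨rfl⟩).2 ?_
  -- For a unit vector `ξ` the scalar is the matrix coefficient ⟨Gξ, Fξ⟩.
  refine (ContinuousAt.inner (𝕜 := ℂ) (hG ξ) (hF ξ)).congr (Eventually.of_forall fun x => ?_)
  change ⟪(G x : H →L[ℂ] H) ξ, (F x : H →L[ℂ] H) ξ⟫_ℂ = (c x : ℂ)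
  rw [h, mul_apply', scalarUnitary_apply, inner_smul_right, inner_self_eq_norm_sq_to_K,
    Unitary.norm_map, hξ]
  simp

theorem continuous_of_eq_scalarUnitary_mul [Nontrivial H] {F G : X → unitary (H →L[ℂ] H)}
    (hF : ∀ ξ : H, Continuous fun x => (F x : H →L[ℂ] H) ξ)
    (hG : ∀ ξ : H, Continuous fun x => (G x : H →L[ℂ] H) ξ) {c : X → Circle}
    (h : ∀ x, F x = scalarUnitary H (c x) * G x) : Continuous c :=
  continuous_iff_continuousAt.2 fun _ => continuousAt_of_eq_scalarUnitary_mul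
    (fun ξ => (hF ξ).continuousAt) (fun ξ => (hG ξ).continuousAt) h

/-- For families of unitaries weak continuity implies strong continuity. -/
theorem continuousAt_unitary_of_inner {F : X → unitary (H →L[ℂ] H)}
    (hF : ∀ ζ ξ : H, ContinuousAt (fun x => ⟪ζ, (F x : H →L[ℂ] H) ξ⟫_ℂ) x₀) (ξ : H) :
    ContinuousAt (fun x => (F x : H →L[ℂ] H) ξ) x₀ := by
  have hsq : ∀ x, ‖(F x : H →L[ℂ] H) ξ - (F x₀ : H →L[ℂ] H) ξ‖ ^ 2 =
      2 * ‖ξ‖ ^ 2 - 2 * (⟪(F x₀ : H →L[ℂ] H) ξ, (F x : H →L[ℂ] H) ξ⟫_ℂ).re := by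
    intro x
    rw [norm_sub_sq (𝕜 := ℂ), ← inner_conj_symm, Unitary.norm_map, Unitary.norm_map]
    simp only [RCLike.re_to_complex, Complex.conj_re]
    ring
  have h1 : ContinuousAt (fun x => ‖(F x : H →L[ℂ] H) ξ - (F x₀ : H →L[ℂ] H) ξ‖ ^ 2) x₀ := by
    simp only [hsq]
    exact continuousAt_const.sub (continuousAt_const.mul
      (Complex.continuous_re.continuousAt.comp (hF _ _)))
  have h2 := h1.sqrt
  simp only [Real.sqrt_sq (norm_nonneg _)] at h2
  rw [ContinuousAt, tendsto_iff_norm_sub_tendsto_zero]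
  simpa [ContinuousAt] using h2

end Scalars

/-! ### Local homomorphisms on the real line -/

section Local

variable {G : Type*} [Group G]

/-- The smaller multiples of `t` have smaller modulus, so the induction never leaves the interval
where `u` is multiplicative. -/
theorem pow_eq_of_local_hom {u : ℝ → G} {δ : ℝ}
    (hu : ∀ s t, |s| ≤ δ → |t| ≤ δ → |s + t| ≤ δ → u (s + t) = u s * u t) (t : ℝ) (n : ℕ)
    (hn : |(n + 1) * t| ≤ δ) : u ((n + 1) * t) = u t ^ (n + 1) := by
  induction n with
  | zero => simp
  | succ k ih =>
    have hk : |(k + 1 : ℝ) * t| ≤ |((k + 1 : ℕ) + 1 : ℝ) * t| := by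
      rw [abs_mul, abs_mul]
      refine mul_le_mul_of_nonneg_right ?_ (abs_nonneg t)
      rw [abs_of_nonneg (by positivity), abs_of_nonneg (by positivity)]
      push_cast
      linarith
    have h1 : |t| ≤ |((k + 1 : ℕ) + 1 : ℝ) * t| := by
      rw [abs_mul, abs_of_nonneg (by positivity : (0 : ℝ) ≤ (k + 1 : ℕ) + 1)]
      have : (0 : ℝ) ≤ (k + 1 : ℕ) := by positivity
      nlinarith [abs_nonneg t]
    have e : ((k + 1 : ℕ) + 1 : ℝ) * t = (k + 1) * t + t := by push_cast; ring
    rw [e] at hn ⊢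
    rw [hu _ _ (hk.trans (e ▸ hn)) (h1.trans (e ▸ hn)) hn, ih (hk.trans (e ▸ hn)), ← pow_succ]

/-- Refining a subdivision of `t` does not change the power. Any two subdivisions have a common
refinement, which makes the extension below well defined. -/
theorem pow_eq_pow_of_local_hom {u : ℝ → G} {δ : ℝ}
    (hu : ∀ s t, |s| ≤ δ → |t| ≤ δ → |s + t| ≤ δ → u (s + t) = u s * u t) (t : ℝ) (n m : ℕ)
    (hn : |t / (n + 1)| ≤ δ) : u (t / (n + 1)) ^ (n + 1) =
      u (t / ((n + 1) * (m + 1))) ^ ((n + 1) * (m + 1)) := by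
  have hm : (m + 1 : ℝ) ≠ 0 := by positivity
  have hn' : (n + 1 : ℝ) ≠ 0 := by positivity
  have e : t / (n + 1) = (m + 1) * (t / ((n + 1) * (m + 1))) := by field_simp
  rw [e] at hn ⊢
  rw [pow_eq_of_local_hom hu _ _ hn, ← pow_mul, mul_comm (m + 1)]

theorem exists_nat_abs_div_le (t : ℝ) {δ : ℝ} (hδ : 0 < δ) : ∃ n : ℕ, |t / (n + 1)| ≤ δ := by
  obtain ⟨n, hn⟩ := exists_nat_ge (|t| / δ)
  refine ⟨n, ?_⟩
  have h0 : (0 : ℝ) < n + 1 := by positivity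
  rw [abs_div, abs_of_pos h0, div_le_iff₀ h0]
  rw [div_le_iff₀ hδ] at hn
  nlinarith

/-- A local homomorphism from the real line to a group extends to a homomorphism. -/
theorem exists_extension_of_local_hom {u : ℝ → G} {δ : ℝ} (hδ : 0 < δ)
    (hu : ∀ s t, |s| ≤ δ → |t| ≤ δ → |s + t| ≤ δ → u (s + t) = u s * u t) :
    ∃ U : ℝ → G, (∀ s t, U (s + t) = U s * U t) ∧ (∀ t, |t| ≤ δ → U t = u t) ∧
      ∀ t : ℝ, ∃ n : ℕ, |t / (n + 1)| ≤ δ ∧ U t = u (t / (n + 1)) ^ (n + 1) := by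
  choose N hN using fun t : ℝ => exists_nat_abs_div_le t hδ
  have key : ∀ (t : ℝ) (n : ℕ), |t / (n + 1)| ≤ δ →
      u (t / (N t + 1)) ^ (N t + 1) = u (t / (n + 1)) ^ (n + 1) := by
    intro t n hn
    rw [pow_eq_pow_of_local_hom hu t _ n (hN t), pow_eq_pow_of_local_hom hu t n (N t) hn,
      mul_comm (n + 1 : ℝ), mul_comm (n + 1)]
  refine ⟨fun t => u (t / (N t + 1)) ^ (N t + 1), fun s t => ?_, fun t ht => ?_,
    fun t => ⟨N t, hN t, rfl⟩⟩
  · obtain ⟨n, hn⟩ := exists_nat_abs_div_le (|s| + |t|) hδ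
    have h0 : (0 : ℝ) < n + 1 := by positivity
    rw [abs_div, abs_of_pos h0, abs_of_nonneg (by positivity)] at hn
    have hs : |s / (n + 1)| ≤ δ := by
      rw [abs_div, abs_of_pos h0]
      refine le_trans ?_ hn
      gcongr
      linarith [abs_nonneg t]
    have ht : |t / (n + 1)| ≤ δ := by
      rw [abs_div, abs_of_pos h0]
      refine le_trans ?_ hn
      gcongr
      linarith [abs_nonneg s]
    have hst : |(s + t) / (n + 1)| ≤ δ := by
      rw [abs_div, abs_of_pos h0]
      refine le_trans ?_ hn
      gcongr
      exact abs_add_le s t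
    have h1 := hu _ _ hs ht (by rwa [← add_div])
    have h2 := hu _ _ ht hs (by rwa [← add_div, add_comm t])
    -- `G` need not be commutative, but ℝ is: both products equal `u` at the same sum. This lets the
    -- power distribute over the product.
    have hc : Commute (u (s / (n + 1))) (u (t / (n + 1))) := by
      rw [Commute, SemiconjBy, ← h1, ← h2, add_comm]
    change u _ ^ _ = u _ ^ _ * u _ ^ _
    rw [key _ n hst, key _ n hs, key _ n ht, ← hc.mul_pow, ← h1, add_div]
  · have := key t 0 (by simpa using ht)
    simpa using this

end Local

/-! ### Cocycles and characters on the real line -/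

section Line

theorem abs_le_of_mem_uIcc {p q x R : ℝ} (hp : |p| ≤ R) (hq : |q| ≤ R) (hx : x ∈ Set.uIcc p q) :
    |x| ≤ R := by
  have h := Set.uIcc_subset_Icc (Set.mem_Icc.2 (abs_le.1 hp)) (Set.mem_Icc.2 (abs_le.1 hq)) hx
  exact abs_le.2 (Set.mem_Icc.1 h)

/-- A continuous real-valued local `2`-cocycle on the real line is a local coboundary. -/
theorem exists_local_coboundary {μ : ℝ → ℝ → ℝ} {r C : ℝ} (hr : 0 < r)
    (hc : ∀ s t, |s| < r → |t| < r → ContinuousAt (fun p : ℝ × ℝ => μ p.1 p.2) (s, t))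
    (h0 : ∀ t, μ 0 t = 0) (hb : ∀ s t, |μ s t| ≤ C)
    (hcoc : ∀ s t u, |s| < r → |t| < r → |u| < r → |s + t| < r → |t + u| < r →
      μ s t + μ (s + t) u = μ s (t + u) + μ t u) :
    ∃ (a : ℝ → ℝ) (δ : ℝ), 0 < δ ∧ a 0 = 0 ∧ ContinuousAt a 0 ∧
      ∀ s t, |s| ≤ δ → |t| ≤ δ → |s + t| ≤ δ → a s + a t - a (s + t) = μ s t := by
  have hc2 : ∀ s t, |s| < r → |t| < r → ContinuousAt (fun x => μ s x) t := fun s t hs ht =>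
    ContinuousAt.comp (f := fun x : ℝ => (s, x)) (hc s t hs ht) (by fun_prop)
  have hc1 : ∀ s t, |s| < r → |t| < r → ContinuousAt (fun x => μ x t) s := fun s t hs ht =>
    ContinuousAt.comp (f := fun x : ℝ => (x, t)) (hc s t hs ht) (by fun_prop)
  -- With `s`, `t`, `s + t` and the integration variables of modulus at most `ε`, all arguments of
  -- `μ` have modulus at most `2 * ε`, well inside `r`.
  obtain ⟨ε, rfl⟩ : ∃ ε, r = 4 * ε := ⟨r / 4, by ring⟩
  have hε : 0 < ε := by linarith
  have hε' : |ε| = ε := abs_of_pos hε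
  have hi2 : ∀ s p q, |s| < 4 * ε → |p| ≤ 2 * ε → |q| ≤ 2 * ε →
      IntervalIntegrable (fun x => μ s x) volume p q := by
    intro s p q hs hp hq
    refine ContinuousOn.intervalIntegrable fun x hx => (hc2 s x hs ?_).continuousWithinAt
    linarith [abs_le_of_mem_uIcc hp hq hx]
  have hi1 : ∀ p q, |p| ≤ 2 * ε → |q| ≤ 2 * ε →
      IntervalIntegrable (fun x => μ x ε) volume p q := by
    intro p q hp hq
    refine ContinuousOn.intervalIntegrable fun x hx =>
      (hc1 x ε ?_ (by linarith)).continuousWithinAt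
    linarith [abs_le_of_mem_uIcc hp hq hx]
  have habs0 : |(0 : ℝ)| ≤ 2 * ε := by rw [abs_zero]; linarith
  -- Averaging the cocycle identity over its last variable suggests the first integral. It leaves
  -- boundary terms because the window [0, ε] is shifted by `t`; the second integral cancels them.
  refine ⟨fun t => ε⁻¹ * ((∫ x in (0 : ℝ)..ε, μ t x) - ∫ x in (0 : ℝ)..t, μ x ε), ε, hε, ?_, ?_, ?_⟩
  · simp [h0]
  · refine continuousAt_const.mul (ContinuousAt.sub ?_ ?_)
    · refine intervalIntegral.continuousAt_of_dominated_interval (bound := fun _ => C) ?_ ?_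
        intervalIntegrable_const ?_
      · filter_upwards [Metric.ball_mem_nhds (0 : ℝ) hε] with t ht
        rw [Metric.mem_ball, Real.dist_eq, sub_zero] at ht
        exact (intervalIntegrable_iff.1
          (hi2 t 0 ε (by linarith) habs0 (by linarith))).aestronglyMeasurable
      · exact Eventually.of_forall fun t => ae_of_all _ fun x _ => hb t x
      · refine ae_of_all _ fun x hx => hc1 0 x (by rw [abs_zero]; linarith) ?_
        have := abs_le_of_mem_uIcc habs0 (by linarith) (Set.uIoc_subset_uIcc hx)
        linarith
    · have h1 : Tendsto (fun t : ℝ => C * |t - 0|) (𝓝 0) (𝓝 0) := by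
        have : Continuous fun t : ℝ => C * |t - 0| := by fun_prop
        simpa using this.tendsto 0
      rw [ContinuousAt, intervalIntegral.integral_same]
      refine squeeze_zero_norm (fun t => ?_) h1
      exact intervalIntegral.norm_integral_le_of_norm_le_const fun x _ => hb x ε
  · intro s t hs ht hst
    -- The cocycle identity at `(s, t, x)`, integrated over `x` from 0 to `ε`.
    have e1 : (∫ x in (0 : ℝ)..ε, μ t x) - (∫ x in (0 : ℝ)..ε, μ (s + t) x) =
        ε * μ s t - ∫ x in t..(t + ε), μ s x := by
      have h1 : (∫ x in t..(t + ε), μ s x) = ∫ x in (0 : ℝ)..ε, μ s (t + x) := by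
        rw [intervalIntegral.integral_comp_add_left (fun x => μ s x) t, add_zero]
      have h2 : ε * μ s t = ∫ _ in (0 : ℝ)..ε, μ s t := by
        rw [intervalIntegral.integral_const, sub_zero, smul_eq_mul]
      have h3 : IntervalIntegrable (fun x => μ s (t + x)) volume 0 ε := by
        have := (hi2 s t (t + ε) (by linarith) (by linarith)
          ((abs_add_le t ε).trans (by linarith))).comp_add_left t
        simpa using this
      rw [h1, h2, ← intervalIntegral.integral_sub
        (hi2 t 0 ε (by linarith) habs0 (by linarith))
        (hi2 (s + t) 0 ε (by linarith) habs0 (by linarith)),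
        ← intervalIntegral.integral_sub intervalIntegrable_const h3]
      refine intervalIntegral.integral_congr fun x hx => ?_
      have hx' := abs_le_of_mem_uIcc (R := ε) (by rw [abs_zero]; exact hε.le) hε'.le hx
      have := hcoc s t x (by linarith) (by linarith) (by linarith) (by linarith)
        ((abs_add_le t x).trans_lt (by linarith))
      linarith
    -- The cocycle identity at `(s, x, ε)`, integrated over `x` from 0 to `t`.
    have e2 : (∫ x in (0 : ℝ)..t, μ s x) + (∫ x in s..(s + t), μ x ε) =
        (∫ x in ε..(ε + t), μ s x) + ∫ x in (0 : ℝ)..t, μ x ε := by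
      have h1 : (∫ x in s..(s + t), μ x ε) = ∫ x in (0 : ℝ)..t, μ (s + x) ε := by
        rw [intervalIntegral.integral_comp_add_left (fun x => μ x ε) s, add_zero]
      have h2 : (∫ x in ε..(ε + t), μ s x) = ∫ x in (0 : ℝ)..t, μ s (ε + x) := by
        rw [intervalIntegral.integral_comp_add_left (fun x => μ s x) ε, add_zero]
      have h3 : IntervalIntegrable (fun x => μ (s + x) ε) volume 0 t := by
        have := (hi1 s (s + t) (by linarith) (by linarith)).comp_add_left s
        simpa using this
      have h4 : IntervalIntegrable (fun x => μ s (ε + x)) volume 0 t := by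
        have := (hi2 s ε (ε + t) (by linarith) (by linarith)
          ((abs_add_le ε t).trans (by linarith))).comp_add_left ε
        simpa using this
      rw [h1, h2, ← intervalIntegral.integral_add
        (hi2 s 0 t (by linarith) habs0 (by linarith)) h3,
        ← intervalIntegral.integral_add h4 (hi1 0 t habs0 (by linarith))]
      refine intervalIntegral.integral_congr fun x hx => ?_
      have hx' := abs_le_of_mem_uIcc (R := ε) (by rw [abs_zero]; exact hε.le) ht hx
      have := hcoc s x ε (by linarith) (by linarith) (by linarith)
        ((abs_add_le s x).trans_lt (by linarith)) ((abs_add_le x ε).trans_lt (by linarith))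
      rw [add_comm ε x]
      linarith
    have e3 : (∫ x in (0 : ℝ)..ε, μ s x) + (∫ x in ε..(ε + t), μ s x) =
        (∫ x in (0 : ℝ)..t, μ s x) + ∫ x in t..(t + ε), μ s x := by
      have hs' : |s| < 4 * ε := by linarith
      have hεt : |ε + t| ≤ 2 * ε := (abs_add_le ε t).trans (by linarith)
      rw [intervalIntegral.integral_add_adjacent_intervals (hi2 s 0 ε hs' habs0 (by linarith))
        (hi2 s ε (ε + t) hs' (by linarith) hεt), add_comm t ε,
        intervalIntegral.integral_add_adjacent_intervals (hi2 s 0 t hs' habs0 (by linarith))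
        (hi2 s t (ε + t) hs' (by linarith) hεt)]
    have e4 := intervalIntegral.integral_add_adjacent_intervals
      (hi1 0 s habs0 (by linarith)) (hi1 s (s + t) (by linarith) (by linarith))
    have e5 : (∫ x in (0 : ℝ)..ε, μ s x) - (∫ x in (0 : ℝ)..s, μ x ε) +
        ((∫ x in (0 : ℝ)..ε, μ t x) - (∫ x in (0 : ℝ)..t, μ x ε)) -
        ((∫ x in (0 : ℝ)..ε, μ (s + t) x) - ∫ x in (0 : ℝ)..(s + t), μ x ε) = ε * μ s t := by
      linarith
    rw [← mul_add, ← mul_sub, e5, inv_mul_cancel_left₀ hε.ne']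

/-- If `a ≠ b`, the quotient of the two characters takes the value -1 at π/(a - b). -/
theorem circle_exp_injective_of_forall {a b : ℝ}
    (h : ∀ t : ℝ, Circle.exp (a * t) = Circle.exp (b * t)) : a = b := by
  by_contra hab
  have hab' : a - b ≠ 0 := sub_ne_zero.2 hab
  have h1 := h (Real.pi / (a - b))
  have h2 : Circle.exp ((a - b) * (Real.pi / (a - b))) = 1 := by
    rw [sub_mul, Circle.exp_sub, h1, div_self']
  rw [mul_div_cancel₀ _ hab'] at h2
  have h3 := congrArg (fun z : Circle => (z : ℂ)) h2
  rw [Circle.coe_exp, Complex.exp_pi_mul_I, Circle.coe_one] at h3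
  norm_num at h3

/-- Both arguments lie in (-π/2, π/2), so their sum does not wrap around. This turns multiplicative
identities near 1 into additive ones. -/
theorem circle_arg_mul {z w : Circle} (hz : 0 < (z : ℂ).re) (hw : 0 < (w : ℂ).re) :
    Complex.arg (z * w : Circle) = Complex.arg z + Complex.arg w := by
  have hz' := abs_lt.1 (Complex.abs_arg_lt_pi_div_two_iff.2 (Or.inl hz))
  have hw' := abs_lt.1 (Complex.abs_arg_lt_pi_div_two_iff.2 (Or.inl hw))
  rw [Circle.coe_mul]
  exact Complex.arg_mul (Circle.coe_ne_zero z) (Circle.coe_ne_zero w)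
    ⟨by linarith [hz'.1, hw'.1], by linarith [hz'.2, hw'.2]⟩

theorem continuousAt_circle_arg {z : Circle} (hz : 0 < (z : ℂ).re) :
    ContinuousAt (fun w : Circle => Complex.arg (w : ℂ)) z :=
  ContinuousAt.comp (f := fun w : Circle => (w : ℂ)) (Complex.continuousAt_arg (Or.inl hz))
    continuous_subtype_val.continuousAt

theorem eventually_re_pos {X : Type*} [TopologicalSpace X] {c : X → Circle} {x₀ : X}
    (hc : ContinuousAt c x₀) (h : c x₀ = 1) : ∀ᶠ x in 𝓝 x₀, 0 < (c x : ℂ).re := by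
  have h1 : ContinuousAt (fun x => (c x : ℂ).re) x₀ :=
    Complex.continuous_re.continuousAt.comp
      (continuous_subtype_val.continuousAt.comp hc)
  exact h1.eventually (lt_mem_nhds (show 0 < (c x₀ : ℂ).re by rw [h, Circle.coe_one]; exact one_pos))

/-- The continuous unitary characters of the real line. -/
theorem exists_eq_exp_of_continuous {χ : ℝ → Circle} (hc : Continuous χ)
    (hadd : ∀ s t, χ (s + t) = χ s * χ t) : ∃ b : ℝ, ∀ t, χ t = Circle.exp (b * t) := by
  have h0 : χ 0 = 1 := by
    have := hadd 0 0
    rw [add_zero] at this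
    exact left_eq_mul.1 this
  obtain ⟨δ, hδ, hball⟩ := Metric.eventually_nhds_iff.1 (eventually_re_pos hc.continuousAt h0)
  have hpos : ∀ t, |t| ≤ δ / 2 → 0 < (χ t : ℂ).re := fun t ht =>
    hball (by rw [Real.dist_eq, sub_zero]; linarith)
  -- Near 0 the argument of `χ` is additive. Its global extension is a real-valued lift of `χ`, and
  -- it is linear because it is continuous at 0.
  obtain ⟨U, hU, hUu, hUn⟩ := exists_extension_of_local_hom (G := Multiplicative ℝ)
    (u := fun t => Multiplicative.ofAdd (Complex.arg (χ t))) (half_pos hδ) (by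
      intro s t hs ht hst
      change Multiplicative.ofAdd _ = Multiplicative.ofAdd (_ + _)
      rw [hadd, circle_arg_mul (hpos s hs) (hpos t ht)]
      rfl)
  let F : ℝ →+ ℝ :=
    { toFun := fun t => (U t).toAdd
      map_zero' := by
        rw [hUu 0 (by rw [abs_zero]; linarith), h0]
        simp
      map_add' := fun s t => by rw [hU]; rfl }
  have hF0 : ContinuousAt F 0 := by
    have h1 : ContinuousAt (fun t => Complex.arg (χ t)) 0 :=
      ContinuousAt.comp (f := χ) (continuousAt_circle_arg (hpos 0 (by rw [abs_zero]; linarith)))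
        hc.continuousAt
    refine h1.congr ?_
    filter_upwards [Metric.ball_mem_nhds (0 : ℝ) (half_pos hδ)] with t ht
    rw [Metric.mem_ball, Real.dist_eq, sub_zero] at ht
    change _ = (U t).toAdd
    rw [hUu t ht.le]
    rfl
  have hF : Continuous F := continuous_of_continuousAt_zero F hF0
  refine ⟨F 1, fun t => ?_⟩
  have h1 : F t = F 1 * t := by
    have := (F.toRealLinearMap hF).map_smul t 1
    simpa [mul_comm] using this
  rw [← h1]
  obtain ⟨n, hn, hn'⟩ := hUn t
  have h2 : F t = (n + 1 : ℕ) * Complex.arg (χ (t / (n + 1))) := by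
    change (U t).toAdd = _
    rw [hn', toAdd_pow, toAdd_ofAdd, nsmul_eq_mul]
  have h3 : ∀ (k : ℕ) (x : ℝ), χ (k * x) = χ x ^ k := by
    intro k x
    induction k with
    | zero => simp [h0]
    | succ k ih => rw [Nat.cast_succ, add_mul, one_mul, hadd, ih, pow_succ]
  rw [h2, ← nsmul_eq_mul, Circle.exp_nsmul, Circle.exp_arg, ← h3]
  congr 1
  push_cast
  field_simp

/-- The separately continuous bicharacters of the real line. -/
theorem exists_eq_exp_mul_of_bicharacter {c : ℝ → ℝ → Circle} (hc1 : ∀ t, Continuous fun s => c s t)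
    (hc2 : ∀ s, Continuous (c s)) (h1 : ∀ s s' t, c (s + s') t = c s t * c s' t)
    (h2 : ∀ s t t', c s (t + t') = c s t * c s t') :
    ∃ b : ℝ, ∀ s t, c s t = Circle.exp (b * s * t) := by
  choose f hf using fun s => exists_eq_exp_of_continuous (hc2 s) (h2 s)
  let F : ℝ →+ ℝ := AddMonoidHom.mk' f fun s s' => circle_exp_injective_of_forall fun t => by
    rw [← hf, h1, hf, hf, add_mul, Circle.exp_add]
  refine ⟨f 1, fun s t => ?_⟩
  -- The exponent `f` is additive but not known to be continuous. Additivity settles rational `s`,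
  -- and continuity of `c` in `s` does the rest.
  have hq : (fun s => c s t) ∘ ((↑) : ℚ → ℝ) =
      (fun s : ℝ => Circle.exp (f 1 * s * t)) ∘ ((↑) : ℚ → ℝ) := by
    funext q
    have : F ((q : ℝ) • 1) = (q : ℝ) • F 1 := map_ratCast_smul F ℝ ℝ q 1
    rw [smul_eq_mul, smul_eq_mul, mul_one] at this
    change c q t = Circle.exp (f 1 * q * t)
    rw [hf, show f q = q * f 1 from this, mul_comm (f 1)]
  exact congrFun (Rat.denseRange_cast.equalizer (hc1 t) (by fun_prop) hq) s

end Line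

/-! ### Implementing one-parameter groups of automorphisms -/

section OneParameter

variable {H : Type*} [NormedAddCommGroup H] [InnerProductSpace ℂ H] [CompleteSpace H]

/-- Rank-one operators make the vectors `u η` visible, up to a scalar factor, in the automorphism
`Ad u`, so continuity of automorphisms can be passed on to unitaries. -/
theorem conj_smulRight_apply (u : unitary (H →L[ℂ] H)) (ξ η ζ : H) :
    Unitary.conjStarAlgAut ℂ (H →L[ℂ] H) u ((innerSL ℂ ξ).smulRight η) ζ =
      ⟪(u : H →L[ℂ] H) ξ, ζ⟫_ℂ • (u : H →L[ℂ] H) η := by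
  have h : ⟪ξ, (star (u : H →L[ℂ] H)) ζ⟫_ℂ = ⟪(u : H →L[ℂ] H) ξ, ζ⟫_ℂ := by
    rw [ContinuousLinearMap.star_eq_adjoint, ContinuousLinearMap.adjoint_inner_right]
  rw [← h, ← map_smul]
  rfl

/-- The free phase is spent on making ⟨ξ, uξ⟩ nonnegative, which determines `u` whenever this number
is nonzero. -/
theorem exists_normalized_unitary (f : (H →L[ℂ] H) ≃⋆ₐ[ℂ] (H →L[ℂ] H)) (ξ : H) :
    ∃ u : unitary (H →L[ℂ] H), f = Unitary.conjStarAlgAut ℂ (H →L[ℂ] H) u ∧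
      ⟪ξ, (u : H →L[ℂ] H) ξ⟫_ℂ = (‖⟪ξ, (u : H →L[ℂ] H) ξ⟫_ℂ‖ : ℂ) := by
  obtain ⟨v, hv⟩ := exists_unitary_conj f
  set z := ⟪ξ, (v : H →L[ℂ] H) ξ⟫_ℂ with hz
  have h : ⟪ξ, ((scalarUnitary H (Circle.exp (-Complex.arg z)) * v : unitary (H →L[ℂ] H)) :
      H →L[ℂ] H) ξ⟫_ℂ = (‖z‖ : ℂ) := by
    rw [mul_apply', scalarUnitary_apply, inner_smul_right, ← hz, Circle.coe_exp]
    nth_rewrite 2 [← Complex.norm_mul_exp_arg_mul_I z]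
    rw [mul_left_comm, ← Complex.exp_add]
    push_cast
    rw [neg_mul, neg_add_cancel, Complex.exp_zero, mul_one]
  refine ⟨scalarUnitary H (Circle.exp (-Complex.arg z)) * v, ?_, ?_⟩
  · rw [map_mul, conj_scalarUnitary, one_mul, hv]
  · rw [h]
    simp

/-- A weakly continuous one-parameter family of automorphisms of `B(H)` is implemented by a family
of unitaries that is strongly continuous near the origin. -/
theorem exists_locally_continuous_unitary [Nontrivial H]
    {β : ℝ → ((H →L[ℂ] H) ≃⋆ₐ[ℂ] (H →L[ℂ] H))} (h0 : β 0 = 1)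
    (hc : ∀ (T : H →L[ℂ] H) (ζ η : H), Continuous fun t => ⟪ζ, β t T η⟫_ℂ) :
    ∃ s : ℝ → unitary (H →L[ℂ] H), (∀ t, β t = Unitary.conjStarAlgAut ℂ (H →L[ℂ] H) (s t)) ∧
      s 0 = 1 ∧ ∃ δ > 0, ∀ t, |t| < δ → ∀ η : H, ContinuousAt (fun t => (s t : H →L[ℂ] H) η) t := by
  obtain ⟨ξ, hξ⟩ := exists_norm_eq (E := H) zero_le_one
  have hξ2 : ⟪ξ, ξ⟫_ℂ = 1 := by
    rw [inner_self_eq_norm_sq_to_K, hξ]; simp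
  choose s hs hn using fun t => exists_normalized_unitary (β t) ξ
  set n : ℝ → ℝ := fun t => ‖⟪ξ, (s t : H →L[ℂ] H) ξ⟫_ℂ‖ with hndef
  have hn' : ∀ t, ⟪(s t : H →L[ℂ] H) ξ, ξ⟫_ℂ = (n t : ℂ) := by
    intro t
    rw [← inner_conj_symm, hn, Complex.conj_ofReal]
  have hmat : ∀ (t : ℝ) (ζ η : H), ⟪ζ, β t ((innerSL ℂ ξ).smulRight η) ξ⟫_ℂ =
      (n t : ℂ) * ⟪ζ, (s t : H →L[ℂ] H) η⟫_ℂ := by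
    intro t ζ η
    rw [hs, conj_smulRight_apply, inner_smul_right, hn']
  -- By `hmat` with both vectors equal to `ξ`, the square of `n` is the modulus of a matrix
  -- coefficient of `β t`.
  have hncont : Continuous n := by
    have h1 : Continuous fun t => Real.sqrt ‖⟪ξ, β t ((innerSL ℂ ξ).smulRight ξ) ξ⟫_ℂ‖ :=
      ((hc _ _ _).norm).sqrt
    refine h1.congr fun t => ?_
    rw [hmat, norm_mul, Complex.norm_real, Real.norm_of_nonneg (norm_nonneg _),
      Real.sqrt_mul_self (norm_nonneg _)]
  have hs0 : s 0 = 1 := by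
    obtain ⟨c, hc⟩ := exists_scalarUnitary_mul (u := s 0) (v := 1) (by rw [← hs, h0, map_one])
    rw [mul_one] at hc
    have h1 := hn 0
    rw [hc, scalarUnitary_apply, inner_smul_right, hξ2, mul_one, Circle.norm_coe] at h1
    rw [hc, show c = 1 from Subtype.ext (by simpa using h1), map_one]
  have hn0 : n 0 = 1 := by
    simp only [hndef, hs0]
    change ‖⟪ξ, ξ⟫_ℂ‖ = 1
    rw [hξ2, norm_one]
  obtain ⟨δ, hδ, hball⟩ := Metric.eventually_nhds_iff.1
    (hncont.continuousAt.eventually (lt_mem_nhds (show 0 < n 0 by rw [hn0]; exact one_pos)))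
  -- Where `n` is positive, `hmat` can be divided by it, which gives weak and hence strong
  -- continuity of `s`.
  refine ⟨s, hs, hs0, δ, hδ, fun t ht η => ?_⟩
  refine continuousAt_unitary_of_inner (fun ζ η => ?_) η
  have hpos : ∀ x, |x| < δ → (n x : ℂ) ≠ 0 := fun x hx =>
    Complex.ofReal_ne_zero.2 (hball (by rwa [Real.dist_eq, sub_zero])).ne'
  have h1 : ContinuousAt (fun x => (n x : ℂ)⁻¹ *
      ⟪ζ, β x ((innerSL ℂ ξ).smulRight η) ξ⟫_ℂ) t :=
    ((Complex.continuous_ofReal.comp hncont).continuousAt.inv₀ (hpos t ht)).mul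
      (hc _ _ _).continuousAt
  refine h1.congr ?_
  filter_upwards [(isOpen_lt continuous_abs continuous_const).mem_nhds ht] with x hx
  rw [hmat, inv_mul_cancel_left₀ (hpos x hx)]

/-- The multiplier of a normalized choice of unitaries is a circle-valued 2-cocycle, continuous near
the origin and equal to 1 there. Its argument is thus a real local cocycle, a local coboundary of
some `a`, and the phases exp(-ia) remove it. -/
theorem exists_local_hom_unitary [Nontrivial H]
    {β : ℝ → ((H →L[ℂ] H) ≃⋆ₐ[ℂ] (H →L[ℂ] H))} (hadd : ∀ s t, β (s + t) = β s * β t)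
    (hc : ∀ (T : H →L[ℂ] H) (ζ η : H), Continuous fun t => ⟪ζ, β t T η⟫_ℂ) :
    ∃ (u : ℝ → unitary (H →L[ℂ] H)) (δ : ℝ), 0 < δ ∧
      (∀ t, β t = Unitary.conjStarAlgAut ℂ (H →L[ℂ] H) (u t)) ∧
      (∀ η : H, ContinuousAt (fun t => (u t : H →L[ℂ] H) η) 0) ∧
      ∀ s t, |s| ≤ δ → |t| ≤ δ → |s + t| ≤ δ → u (s + t) = u s * u t := by
  have h0 : β 0 = 1 := by
    have := hadd 0 0
    rw [add_zero] at this
    exact left_eq_mul.1 this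
  obtain ⟨v, hv, hv0, δ, hδ, hvc⟩ := exists_locally_continuous_unitary h0 hc
  choose m hm using fun s t => exists_scalarUnitary_mul (u := v s * v t) (v := v (s + t))
    (by rw [map_mul, ← hv, ← hv, ← hv, hadd])
  have hm0 : ∀ t, m 0 t = 1 := by
    intro t
    refine scalarUnitary_injective (H := H) ?_
    have := hm 0 t
    rw [hv0, one_mul, zero_add] at this
    rw [map_one]
    exact (right_eq_mul.1 this)
  have hmcoc : ∀ s t r, m s t * m (s + t) r = m s (t + r) * m t r := by
    intro s t r
    refine scalarUnitary_injective (H := H) ?_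
    have h1 : v s * v t * v r = scalarUnitary H (m s t * m (s + t) r) * v (s + t + r) := by
      rw [hm, mul_assoc, hm, map_mul, mul_assoc]
    have h2 : v s * (v t * v r) = scalarUnitary H (m s (t + r) * m t r) * v (s + t + r) := by
      rw [hm, scalarUnitary_left_comm, hm, mul_comm (m s _), map_mul, mul_assoc, add_assoc]
    rw [mul_assoc, h2] at h1
    exact (mul_right_cancel h1).symm
  have hmc : ∀ s t, |s| < δ / 2 → |t| < δ / 2 →
      ContinuousAt (fun p : ℝ × ℝ => m p.1 p.2) (s, t) := by
    intro s t hs ht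
    have comp : ∀ (f : ℝ × ℝ → ℝ), Continuous f → |f (s, t)| < δ → ∀ η : H,
        ContinuousAt (fun p => (v (f p) : H →L[ℂ] H) η) (s, t) := fun f hf h η =>
      ContinuousAt.comp (f := f) (hvc _ h η) hf.continuousAt
    refine continuousAt_of_eq_scalarUnitary_mul (H := H) (F := fun p => v p.1 * v p.2)
      (G := fun p => v (p.1 + p.2)) (fun η => continuousAt_unitary_mul
        (comp _ continuous_fst (by simp only; linarith))
        (comp _ continuous_snd (by simp only; linarith)) η)
      (comp _ (continuous_fst.add continuous_snd) ((abs_add_le s t).trans_lt (by linarith)))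
      fun p => hm p.1 p.2
  obtain ⟨r, hr, hball⟩ := Metric.eventually_nhds_iff.1
    (eventually_re_pos (hmc 0 0 (by simpa using hδ) (by simpa using hδ)) (hm0 0))
  have hpos : ∀ s t, |s| < r → |t| < r → 0 < (m s t : ℂ).re := by
    intro s t hs ht
    refine @hball (s, t) ?_
    rw [Prod.dist_eq, Real.dist_eq, Real.dist_eq, sub_zero, sub_zero]
    exact max_lt hs ht
  obtain ⟨a, ε, hε, ha0, hac, ha⟩ := exists_local_coboundary (μ := fun s t => Complex.arg (m s t))
    (r := min (δ / 2) r) (C := Real.pi) (lt_min (half_pos hδ) hr)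
    (fun s t hs ht => by
      rw [lt_min_iff] at hs ht
      exact ContinuousAt.comp (f := fun p : ℝ × ℝ => m p.1 p.2)
        (continuousAt_circle_arg (hpos s t hs.2 ht.2)) (hmc s t hs.1 ht.1))
    (fun t => by rw [hm0]; simp) (fun s t => Complex.abs_arg_le_pi _)
    (fun s t u hs ht hu hst htu => by
      rw [lt_min_iff] at hs ht hu hst htu
      rw [← circle_arg_mul (hpos _ _ hs.2 ht.2) (hpos _ _ hst.2 hu.2),
        ← circle_arg_mul (hpos _ _ hs.2 htu.2) (hpos _ _ ht.2 hu.2), hmcoc])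
  refine ⟨fun t => scalarUnitary H (Circle.exp (-a t)) * v t, ε, hε, fun t => ?_, fun η => ?_,
    fun s t hs ht hst => ?_⟩
  · rw [map_mul, conj_scalarUnitary, one_mul, hv]
  · refine continuousAt_unitary_mul (continuousAt_scalarUnitary ?_)
      (hvc 0 (by rw [abs_zero]; exact hδ)) η
    exact Circle.exp.continuous.continuousAt.comp hac.neg
  · have h1 : -a (s + t) = -a s + -a t + Complex.arg (m s t) := by
      have := ha s t hs ht hst
      linarith
    simp only
    rw [h1, Circle.exp_add, Circle.exp_add, Circle.exp_arg, scalarUnitary_left_comm,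
      mul_assoc (scalarUnitary H _) (v s), hm, ← mul_assoc, ← mul_assoc, ← map_mul (scalarUnitary H), ← map_mul (scalarUnitary H),
      mul_comm (Circle.exp (-a t))]

/-- A weakly continuous one-parameter group of automorphisms of `B(H)` is implemented by a strongly
continuous one-parameter group of unitaries. -/
theorem exists_oneParameterUnitary [Nontrivial H]
    {β : ℝ → ((H →L[ℂ] H) ≃⋆ₐ[ℂ] (H →L[ℂ] H))} (hadd : ∀ s t, β (s + t) = β s * β t)
    (hc : ∀ (T : H →L[ℂ] H) (ζ η : H), Continuous fun t => ⟪ζ, β t T η⟫_ℂ) :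
    ∃ U : ℝ → unitary (H →L[ℂ] H), (∀ s t, U (s + t) = U s * U t) ∧
      (∀ η : H, Continuous fun t => (U t : H →L[ℂ] H) η) ∧
      ∀ t, β t = Unitary.conjStarAlgAut ℂ (H →L[ℂ] H) (U t) := by
  obtain ⟨u, δ, hδ, hu, huc, huadd⟩ := exists_local_hom_unitary hadd hc
  obtain ⟨U, hU, hUu, hUn⟩ := exists_extension_of_local_hom hδ huadd
  have hU0 : ∀ η : H, ContinuousAt (fun t => (U t : H →L[ℂ] H) η) 0 := fun η => by
    refine (huc η).congr ?_
    filter_upwards [Metric.ball_mem_nhds (0 : ℝ) hδ] with t ht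
    rw [Metric.mem_ball, Real.dist_eq, sub_zero] at ht
    rw [hUu t ht.le]
  refine ⟨U, hU, fun η => continuous_iff_continuousAt.2 fun t₀ => ?_, fun t => ?_⟩
  -- The group law moves continuity at 0 to `t₀`.
  · have h1 : ContinuousAt (fun t => (U t₀ : H →L[ℂ] H) ((U (t - t₀) : H →L[ℂ] H) η)) t₀ := by
      refine (U t₀ : H →L[ℂ] H).continuous.continuousAt.comp ?_
      refine ContinuousAt.comp (f := fun t => t - t₀)
        (g := fun t => (U t : H →L[ℂ] H) η) ?_ (by fun_prop)
      rw [sub_self]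
      exact hU0 η
    refine h1.congr (Eventually.of_forall fun t => ?_)
    change ((U t₀ * U (t - t₀) : unitary (H →L[ℂ] H)) : H →L[ℂ] H) η = (U t : H →L[ℂ] H) η
    rw [← hU, add_sub_cancel]
  · obtain ⟨n, -, hn⟩ := hUn t
    rw [hn, map_pow, ← hu]
    have hpow : ∀ (k : ℕ) (x : ℝ), β ((k + 1) * x) = β x ^ (k + 1) := by
      intro k x
      induction k with
      | zero => simp
      | succ k ih => rw [Nat.cast_succ, add_mul _ 1, one_mul, hadd, ih, pow_succ _ (k + 1)]
    rw [← hpow, mul_div_cancel₀ _ (by positivity)]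

end OneParameter

/-! ### Implementing automorphism groups indexed by a vector space -/

section Projective

variable {H : Type*} [NormedAddCommGroup H] [InnerProductSpace ℂ H] [CompleteSpace H]
variable {F : Type*} [AddCommGroup F] [Module ℝ F] [TopologicalSpace F] [ContinuousSMul ℝ F]

/-- A projective unitary representation `V` whose multiplier is the exponential of a bilinear form
commutes with a commuting (modulo scalars) one-parameter group up to the exponential of a linear
form. -/
theorem exists_linear_commutator [Nontrivial H] {U : ℝ → unitary (H →L[ℂ] H)}
    {V : F → unitary (H →L[ℂ] H)} {B : F →ₗ[ℝ] F →ₗ[ℝ] ℝ}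
    (hU : ∀ s t, U (s + t) = U s * U t) (hUc : ∀ η : H, Continuous fun t => (U t : H →L[ℂ] H) η)
    (hV : ∀ x y, V x * V y = scalarUnitary H (Circle.exp (B x y)) * V (x + y))
    (hVc : ∀ η : H, Continuous fun x => (V x : H →L[ℂ] H) η)
    (hcomm : ∀ t x, Unitary.conjStarAlgAut ℂ (H →L[ℂ] H) (U t * V x) =
      Unitary.conjStarAlgAut ℂ (H →L[ℂ] H) (V x * U t)) :
    ∃ ℓ : F →ₗ[ℝ] ℝ, ∀ t x, U t * V x = scalarUnitary H (Circle.exp (t * ℓ x)) * (V x * U t) := by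
  choose χ hχ using fun t x => exists_scalarUnitary_mul (hcomm t x)
  have hadd1 : ∀ s t x, χ (s + t) x = χ s x * χ t x := by
    intro s t x
    refine scalarUnitary_injective (H := H) (mul_right_cancel (b := V x * U (s + t)) ?_)
    rw [← hχ, hU, mul_assoc, hχ, scalarUnitary_left_comm, ← mul_assoc (U s), hχ, mul_assoc,
      ← mul_assoc (scalarUnitary H (χ t x)), ← map_mul, mul_comm (χ s x), mul_assoc]
  -- `V` is only projective, but its multiplier appears on both sides of the commutation relation
  -- and cancels.
  have hadd2 : ∀ t x y, χ t (x + y) = χ t x * χ t y := by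
    intro t x y
    refine scalarUnitary_injective (H := H) (mul_right_cancel (b := V x * V y * U t) ?_)
    have h1 : U t * (V x * V y) = scalarUnitary H (χ t (x + y)) * (V x * V y * U t) := by
      rw [hV, scalarUnitary_left_comm, hχ, mul_assoc, scalarUnitary_left_comm]
    rw [← h1, ← mul_assoc, hχ, mul_assoc, mul_assoc, hχ, scalarUnitary_left_comm, map_mul]
    simp only [mul_assoc]
  have hc1 : ∀ x, Continuous fun t => χ t x := fun x =>
    continuous_of_eq_scalarUnitary_mul (H := H) (F := fun t => U t * V x)
      (G := fun t => V x * U t) (continuous_unitary_mul hUc fun _ => continuous_const)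
      (continuous_unitary_mul (fun _ => continuous_const) hUc) fun t => hχ t x
  have hc2 : ∀ t, Continuous fun x => χ t x := fun t =>
    continuous_of_eq_scalarUnitary_mul (H := H) (F := fun x => U t * V x)
      (G := fun x => V x * U t) (continuous_unitary_mul (fun _ => continuous_const) hVc)
      (continuous_unitary_mul hVc fun _ => continuous_const) fun x => hχ t x
  -- On each line ℝx the commutator is a bicharacter of ℝ × ℝ; the two-variable form of the result
  -- gives the homogeneity of `f`.
  have key : ∀ x, ∃ b : ℝ, ∀ s t, χ s (t • x) = Circle.exp (b * s * t) := fun x =>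
    exists_eq_exp_mul_of_bicharacter (c := fun s t => χ s (t • x)) (fun t => hc1 (t • x))
      (fun s => (hc2 s).comp (by fun_prop)) (fun s s' t => hadd1 s s' (t • x))
      (fun s t t' => by rw [add_smul, hadd2])
  choose f hf using key
  have hf' : ∀ x s, χ s x = Circle.exp (f x * s) := by
    intro x s
    have := hf x s 1
    rwa [one_smul, mul_one] at this
  refine ⟨{ toFun := f, map_add' := fun x y => ?_, map_smul' := fun r x => ?_ }, fun t x => ?_⟩
  · refine circle_exp_injective_of_forall fun t => ?_
    rw [← hf', hadd2, hf', hf', add_mul, Circle.exp_add]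
  · refine circle_exp_injective_of_forall fun t => ?_
    rw [← hf', hf]
    congr 1
    simp only [RingHom.id_apply, smul_eq_mul]
    ring
  · rw [hχ, hf', mul_comm (f x)]
    rfl

variable {ι : Type*}

/-- Commuting (modulo scalars) one-parameter unitary groups along the vectors of a basis combine to
a projective representation whose multiplier is the exponential of a bilinear form. -/
theorem exists_projective_representation_finset [Nontrivial H] [IsTopologicalAddGroup F] [T2Space F]
    [FiniteDimensional ℝ F]
    (b : Module.Basis ι ℝ F) {β : F → ((H →L[ℂ] H) ≃⋆ₐ[ℂ] (H →L[ℂ] H))}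
    (hβ : ∀ x y, β (x + y) = β x * β y) {U : ι → ℝ → unitary (H →L[ℂ] H)}
    (hU : ∀ i s t, U i (s + t) = U i s * U i t)
    (hUc : ∀ i (η : H), Continuous fun t => (U i t : H →L[ℂ] H) η)
    (hUβ : ∀ i t, β (t • b i) = Unitary.conjStarAlgAut ℂ (H →L[ℂ] H) (U i t)) (s : Finset ι) :
    ∃ (V : F → unitary (H →L[ℂ] H)) (B : F →ₗ[ℝ] F →ₗ[ℝ] ℝ),
      (∀ η : H, Continuous fun x => (V x : H →L[ℂ] H) η) ∧
      (∀ x, β (∑ i ∈ s, b.coord i x • b i) = Unitary.conjStarAlgAut ℂ (H →L[ℂ] H) (V x)) ∧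
      ∀ x y, V x * V y = scalarUnitary H (Circle.exp (B x y)) * V (x + y) := by
  classical
  induction s using Finset.induction_on with
  | empty =>
    refine ⟨fun _ => 1, 0, fun _ => continuous_const, fun x => ?_, fun x y => ?_⟩
    · have := hβ 0 0
      rw [add_zero] at this
      rw [Finset.sum_empty, map_one, left_eq_mul.1 this]
    · simp
  | insert j s hj ih =>
    obtain ⟨V, B, hVc, hVβ, hV⟩ := ih
    obtain ⟨ℓ, hℓ⟩ := exists_linear_commutator (hU j) (hUc j) hV hVc (by
      intro t x
      rw [map_mul, map_mul, ← hUβ, ← hVβ, ← hβ, ← hβ, add_comm])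
    have hcoord : Continuous (b.coord j) := LinearMap.continuous_of_finiteDimensional _
    -- Moving `U j` at the coordinate of `x` past `V y` costs the exponential of that coordinate
    -- times `ℓ y`, which is the bilinear term added to `B`.
    refine ⟨fun x => V x * U j (b.coord j x), B + (LinearMap.lsmul ℝ ℝ).compl₁₂ (b.coord j) ℓ,
      continuous_unitary_mul hVc fun η => (hUc j η).comp hcoord, fun x => ?_, fun x y => ?_⟩
    · rw [Finset.sum_insert hj, add_comm, hβ, hUβ, hVβ, map_mul]
    · have hB : (B + (LinearMap.lsmul ℝ ℝ).compl₁₂ (b.coord j) ℓ) x y =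
          b.coord j x * ℓ y + B x y := by
        simp [add_comm]
      simp only
      rw [hB, map_add (b.coord j), Circle.exp_add, map_mul (scalarUnitary H), hU]
      calc V x * U j (b.coord j x) * (V y * U j (b.coord j y))
          = V x * (U j (b.coord j x) * V y) * U j (b.coord j y) := by simp only [mul_assoc]
        _ = scalarUnitary H (Circle.exp (b.coord j x * ℓ y)) * (V x * V y) *
              (U j (b.coord j x) * U j (b.coord j y)) := by
            rw [hℓ, scalarUnitary_left_comm]
            simp only [mul_assoc]
        _ = _ := by
            rw [hV]
            simp only [mul_assoc]

/-- Let `β` be a group of automorphisms of `B(H)` that is weakly continuous along the vectors of a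
basis. Then it is implemented by a strongly continuous projective representation whose multiplier is
the exponential of a bilinear form. -/
theorem exists_projective_representation [Nontrivial H] [IsTopologicalAddGroup F] [T2Space F]
    [FiniteDimensional ℝ F] [Finite ι] (b : Module.Basis ι ℝ F) {β : F → ((H →L[ℂ] H) ≃⋆ₐ[ℂ] (H →L[ℂ] H))}
    (hβ : ∀ x y, β (x + y) = β x * β y)
    (hβc : ∀ (i : ι) (T : H →L[ℂ] H) (ζ η : H), Continuous fun t : ℝ => ⟪ζ, β (t • b i) T η⟫_ℂ) :
    ∃ (V : F → unitary (H →L[ℂ] H)) (B : F →ₗ[ℝ] F →ₗ[ℝ] ℝ),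
      (∀ η : H, Continuous fun x => (V x : H →L[ℂ] H) η) ∧
      (∀ x, β x = Unitary.conjStarAlgAut ℂ (H →L[ℂ] H) (V x)) ∧
      ∀ x y, V x * V y = scalarUnitary H (Circle.exp (B x y)) * V (x + y) := by
  have := Fintype.ofFinite ι
  choose U hU hUc hUβ using fun i => exists_oneParameterUnitary (β := fun t => β (t • b i))
    (fun s t => by rw [add_smul, hβ]) (hβc i)
  obtain ⟨V, B, hVc, hVβ, hV⟩ :=
    exists_projective_representation_finset b hβ hU hUc hUβ Finset.univ
  refine ⟨V, B, hVc, fun x => ?_, hV⟩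
  rw [← hVβ]
  congr 1
  exact (b.sum_repr x).symm


end Projective

/-! ### The multiplier of the twisted translations -/

section Twisted

variable {d : ℕ}

instance nontrivial_L2 : Nontrivial (L2 d) := by
  refine ⟨indicatorConstLp 2 (measurableSet_ball (x := (0 : E d)) (ε := 1))
    measure_ball_lt_top.ne (1 : ℂ), 0, fun h => ?_⟩
  have h1 := congrArg norm h
  rw [norm_indicatorConstLp (by norm_num) (by norm_num), norm_zero, norm_one, one_mul] at h1
  have h2 : 0 < (volume : Measure (E d)).real (Metric.ball 0 1) :=
    ENNReal.toReal_pos (Metric.measure_ball_pos _ _ one_pos).ne' measure_ball_lt_top.ne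
  exact (Real.rpow_pos_of_pos h2 _).ne' h1

/-- The bilinear form `⟨Ax, y⟩`. -/
def matrixForm (A : StrictUpper d) : E d →ₗ[ℝ] E d →ₗ[ℝ] ℝ :=
  (innerₗ (E d)).comp (Matrix.toEuclideanLin A.1)

theorem matrixForm_apply (A : StrictUpper d) (x y : E d) :
    matrixForm A x y = ⟪Matrix.toEuclideanLin A.1 x, y⟫_ℝ := rfl

/-- The indices are transposed, since ⟨Aeᵢ, eⱼ⟩ reads column `i` of the matrix. -/
theorem matrixForm_single (A : StrictUpper d) (i j : Fin d) :
    matrixForm A (EuclideanSpace.single i 1) (EuclideanSpace.single j 1) = A.1 j i := by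
  rw [matrixForm_apply, EuclideanSpace.inner_single_right]
  simp

theorem coe_exp_matrixForm (A : StrictUpper d) (x y : E d) :
    (Circle.exp (matrixForm A x y) : ℂ) = omega A x y := by
  rw [Circle.coe_exp, matrixForm_apply, omega, mul_comm]

theorem twistedTranslation_mul_unitary (A : StrictUpper d) (x y : E d) :
    twistedTranslation A x * twistedTranslation A y =
      scalarUnitary (L2 d) (Circle.exp (matrixForm A x y)) * twistedTranslation A (x + y) :=
  Subtype.ext (by
    rw [Submonoid.coe_mul, Submonoid.coe_mul, coe_scalarUnitary, coe_exp_matrixForm,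
      smul_mul_assoc, one_mul, twistedTranslation_mul])

theorem forall_eq_of_single {D D' : E d →ₗ[ℝ] E d →ₗ[ℝ] ℝ}
    (h : ∀ i j, D (EuclideanSpace.single i 1) (EuclideanSpace.single j 1) =
      D' (EuclideanSpace.single i 1) (EuclideanSpace.single j 1)) : D = D' := by
  refine (EuclideanSpace.basisFun (Fin d) ℝ).toBasis.ext fun i =>
    (EuclideanSpace.basisFun (Fin d) ℝ).toBasis.ext fun j => ?_
  simpa using h i j

/-- Every bilinear form differs from the form of some strictly upper triangular matrix by a
symmetric form. -/
theorem exists_strictUpper_sub_symm (B : E d →ₗ[ℝ] E d →ₗ[ℝ] ℝ) :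
    ∃ A : StrictUpper d, ∀ x y, B x y - matrixForm A x y = B y x - matrixForm A y x := by
  set e : Fin d → E d := fun i => EuclideanSpace.single i 1
  -- For `i < j` the form of `A` vanishes at `(e i, e j)` and equals `A i j` at `(e j, e i)`, so
  -- symmetry of the difference forces this entry.
  let A : StrictUpper d := ⟨fun i j => if i < j then B (e j) (e i) - B (e i) (e j) else 0,
    fun i j hij => if_neg hij.not_gt⟩
  have hA : ∀ i j, A.1 i j = if i < j then B (e j) (e i) - B (e i) (e j) else 0 := fun _ _ => rfl
  have h : B - matrixForm A = (B - matrixForm A).flip := by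
    refine forall_eq_of_single fun i j => ?_
    simp only [LinearMap.flip_apply, LinearMap.sub_apply, matrixForm_single, hA]
    rcases lt_trichotomy i j with hij | rfl | hij
    · rw [if_neg hij.not_gt, if_pos hij]
      ring
    · rfl
    · rw [if_neg hij.not_gt, if_pos hij]
      ring
  exact ⟨A, fun x y => LinearMap.congr_fun₂ h x y⟩

/-- A strictly upper triangular matrix is determined by the antisymmetrization of its form. -/
theorem strictUpper_eq_of_antisymm {A B : StrictUpper d}
    (h : ∀ x y, matrixForm A x y - matrixForm A y x = matrixForm B x y - matrixForm B y x) :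
    A = B := by
  refine Subtype.ext (Matrix.ext fun i j => ?_)
  rcases lt_or_ge i j with hij | hij
  · have h1 := h (EuclideanSpace.single j 1) (EuclideanSpace.single i 1)
    simp only [matrixForm_single] at h1
    rw [A.2 j i hij.le, B.2 j i hij.le] at h1
    linarith
  · rw [A.2 i j hij, B.2 i j hij]

end Twisted

/-! ### Injectivity -/

section Injective

variable {d : ℕ} {P : PointedCone ℝ (E d)}

theorem conjUnitary_mul {H K : Type*} [NormedAddCommGroup H] [InnerProductSpace ℂ H]
    [CompleteSpace H] [NormedAddCommGroup K] [InnerProductSpace ℂ K] [CompleteSpace K]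
    (U : H ≃ₗᵢ[ℂ] K) (V W : unitary (H →L[ℂ] H)) :
    conjUnitary U (V * W) = conjUnitary U V * conjUnitary U W :=
  Subtype.ext (map_mul U.conjStarAlgEquiv (V : H →L[ℂ] H) (W : H →L[ℂ] H))

theorem conjUnitary_scalarUnitary {H K : Type*} [NormedAddCommGroup H] [InnerProductSpace ℂ H]
    [CompleteSpace H] [NormedAddCommGroup K] [InnerProductSpace ℂ K] [CompleteSpace K]
    (U : H ≃ₗᵢ[ℂ] K) (c : Circle) : conjUnitary U (scalarUnitary H c) = scalarUnitary K c := by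
  refine Subtype.ext (ContinuousLinearMap.ext fun ξ => ?_)
  rw [coe_conjUnitary, LinearIsometryEquiv.conjStarAlgEquiv_apply_apply, scalarUnitary_apply,
    scalarUnitary_apply, map_smul, LinearIsometryEquiv.apply_symm_apply]

/-- The commutation relation determined by a multiplier. -/
theorem commutation_of_multiplier {H : Type*} [NormedAddCommGroup H] [InnerProductSpace ℂ H]
    [CompleteSpace H] {v w z : unitary (H →L[ℂ] H)} {p q : ℝ}
    (h1 : v * w = scalarUnitary H (Circle.exp p) * z)
    (h2 : w * v = scalarUnitary H (Circle.exp q) * z) :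
    v * w = scalarUnitary H (Circle.exp (p - q)) * (w * v) := by
  rw [h1, h2, ← mul_assoc, ← map_mul, ← Circle.exp_add, sub_add_cancel]

theorem scalarUnitary_mul_mul_inv {H : Type*} [NormedAddCommGroup H] [InnerProductSpace ℂ H]
    [CompleteSpace H] (c : Circle) (u v : unitary (H →L[ℂ] H)) :
    scalarUnitary H c * u * (scalarUnitary H c * v)⁻¹ = u * v⁻¹ := by
  rw [← scalarUnitary_mul_comm, ← scalarUnitary_mul_comm, mul_inv_rev, mul_assoc,
    mul_inv_cancel_left]

/-- The commutation relation of two unitaries depends only on their classes modulo scalars. -/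
theorem commutation_unique {H : Type*} [NormedAddCommGroup H] [InnerProductSpace ℂ H]
    [CompleteSpace H] [Nontrivial H] {a b v w : unitary (H →L[ℂ] H)} {c c' e e' : Circle}
    (ha : a = scalarUnitary H c * v) (hb : b = scalarUnitary H c' * w)
    (hab : a * b = scalarUnitary H e * (b * a)) (hvw : v * w = scalarUnitary H e' * (w * v)) :
    e = e' := by
  have h1 : a * b = scalarUnitary H (c' * c) * (v * w) := by
    rw [ha, hb, mul_assoc, scalarUnitary_left_comm, scalarUnitary_left_comm, map_mul, mul_assoc,
      ← scalarUnitary_left_comm]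
  have h2 : b * a = scalarUnitary H (c' * c) * (w * v) := by
    rw [ha, hb, mul_assoc, scalarUnitary_left_comm, map_mul, mul_assoc]
  refine scalarUnitary_injective (H := H) (mul_right_cancel (b := b * a) ?_)
  rw [← hab, h1, hvw, h2, scalarUnitary_left_comm]

/-- The cocycle identity is exactly what makes the perturbed unitaries `W x * twistedTranslation B
x` keep the multiplier of `B`. -/
theorem cocycle_mul_twistedTranslation {B : StrictUpper d}
    {W : P → unitary (L2 d →L[ℂ] L2 d)} (hW : IsCocycle (twistedE0 P B) W) (x y : P) :
    (W x * twistedTranslation B (x : E d)) * (W y * twistedTranslation B (y : E d)) =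
      scalarUnitary (L2 d) (Circle.exp (matrixForm B x y)) *
        (W (x + y) * twistedTranslation B (x + y : E d)) := by
  have h1 : W x * (twistedTranslation B (x : E d) * W y * (twistedTranslation B (x : E d))⁻¹) =
      W (x + y) := Subtype.ext (hW.mul x y)
  rw [← h1, ← scalarUnitary_left_comm, ← twistedTranslation_mul_unitary]
  group

theorem conjUnitary_twistedTranslation_mul {K : Type*} [NormedAddCommGroup K]
    [InnerProductSpace ℂ K] [CompleteSpace K] (U : L2 d ≃ₗᵢ[ℂ] K) (A : StrictUpper d) (x y : E d) :
    conjUnitary U (twistedTranslation A x) * conjUnitary U (twistedTranslation A y) =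
      scalarUnitary K (Circle.exp (matrixForm A x y)) *
        conjUnitary U (twistedTranslation A (x + y)) := by
  rw [← conjUnitary_mul, twistedTranslation_mul_unitary, conjUnitary_mul,
    conjUnitary_scalarUnitary]

theorem conj_conjUnitary {H K : Type*} [NormedAddCommGroup H] [InnerProductSpace ℂ H]
    [CompleteSpace H] [NormedAddCommGroup K] [InnerProductSpace ℂ K] [CompleteSpace K]
    (U : H ≃ₗᵢ[ℂ] K) (V : unitary (H →L[ℂ] H)) (T : K →L[ℂ] K) :
    Unitary.conjStarAlgAut ℂ (K →L[ℂ] K) (conjUnitary U V) T =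
      U.conjStarAlgEquiv (Unitary.conjStarAlgAut ℂ (H →L[ℂ] H) V (U.conjStarAlgEquiv.symm T)) := by
  rw [Unitary.conjStarAlgAut_apply, Unitary.conjStarAlgAut_apply, map_mul, map_mul, map_star,
    StarAlgEquiv.apply_symm_apply, coe_conjUnitary]

/-- The transported unitaries of `A` and the perturbed unitaries of `B` implement the same
automorphisms. They differ by phases, which commutators do not see. -/
theorem exp_antisymm_eq_of_cocycleConjugate {A B : StrictUpper d}
    (h : CocycleConjugate (twistedE0 P A) (twistedE0 P B)) (x y : P) :
    Circle.exp (matrixForm A x y - matrixForm A y x) =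
      Circle.exp (matrixForm B x y - matrixForm B y x) := by
  obtain ⟨U, W, hW, h⟩ := h
  have hav : ∀ x : P, ∃ c : Circle, conjUnitary U (twistedTranslation A (x : E d)) =
      scalarUnitary (L2 d) c * (W x * twistedTranslation B (x : E d)) := by
    intro x
    refine exists_scalarUnitary_mul (StarAlgEquiv.ext fun T => ?_)
    rw [Unitary.conjStarAlgAut_mul_apply, conj_conjUnitary]
    exact h x T
  obtain ⟨c, hc⟩ := hav x
  obtain ⟨c', hc'⟩ := hav y
  refine commutation_unique hc hc'
    (commutation_of_multiplier (conjUnitary_twistedTranslation_mul U A x y) ?_)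
    (commutation_of_multiplier (cocycle_mul_twistedTranslation hW x y) ?_)
  · rw [add_comm]
    exact conjUnitary_twistedTranslation_mul U A y x
  · rw [add_comm x, add_comm (x : E d)]
    exact cocycle_mul_twistedTranslation hW y x

/-- One pair of vectors gives equality only modulo 2π. Replacing `y` by `t • y` with `t ≥ 0` stays
in the cone, and inversion supplies negative `t`, so two characters of ℝ coincide. -/
theorem antisymm_eq_of_cocycleConjugate {A B : StrictUpper d}
    (h : CocycleConjugate (twistedE0 P A) (twistedE0 P B)) (x y : P) :
    matrixForm A x y - matrixForm A y x = matrixForm B x y - matrixForm B y x := by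
  have hpos : ∀ t : ℝ, 0 ≤ t → Circle.exp ((matrixForm A x y - matrixForm A y x) * t) =
      Circle.exp ((matrixForm B x y - matrixForm B y x) * t) := by
    intro t ht
    have h1 := exp_antisymm_eq_of_cocycleConjugate h x
      ⟨t • (y : E d), P.smul_mem ht y.2⟩
    simp only [map_smul, LinearMap.smul_apply, smul_eq_mul] at h1
    rwa [← mul_sub, ← mul_sub, mul_comm t, mul_comm t] at h1
  refine circle_exp_injective_of_forall fun t => ?_
  rcases le_total 0 t with ht | ht
  · exact hpos t ht
  · have h1 := hpos (-t) (by linarith)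
    rwa [mul_neg, mul_neg, Circle.exp_neg, Circle.exp_neg, inv_inj] at h1

theorem twistedClass_injective (hspanning : ∀ z : E d, ∃ x ∈ P, ∃ y ∈ P, z = x - y) :
    Function.Injective (twistedClass P) := by
  intro A B hAB
  have h : CocycleConjugate (twistedE0 P A) (twistedE0 P B) := Quotient.exact hAB
  refine strictUpper_eq_of_antisymm fun z w => ?_
  obtain ⟨x, hx, y, hy, rfl⟩ := hspanning z
  obtain ⟨x', hx', y', hy', rfl⟩ := hspanning w
  have h1 := antisymm_eq_of_cocycleConjugate h ⟨x, hx⟩ ⟨x', hx'⟩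
  have h2 := antisymm_eq_of_cocycleConjugate h ⟨x, hx⟩ ⟨y', hy'⟩
  have h3 := antisymm_eq_of_cocycleConjugate h ⟨y, hy⟩ ⟨x', hx'⟩
  have h4 := antisymm_eq_of_cocycleConjugate h ⟨y, hy⟩ ⟨y', hy'⟩
  simp only [map_sub, LinearMap.sub_apply] at h1 h2 h3 h4 ⊢
  linarith

end Injective

/-! ### Surjectivity -/

section Surjective

variable {d : ℕ} {P : PointedCone ℝ (E d)}

theorem isNormalFunctional_inner {H : Type*} [NormedAddCommGroup H] [InnerProductSpace ℂ H]
    (ζ η : H) : IsNormalFunctional fun T : H →L[ℂ] H => ⟪ζ, T η⟫_ℂ := by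
  refine ⟨fun n => if n = 0 then ζ else 0, fun n => if n = 0 then η else 0, ?_, ?_, fun T => ?_⟩
  · refine summable_of_ne_finset_zero (s := {0}) fun n hn => ?_
    simp [Finset.notMem_singleton.1 hn]
  · refine summable_of_ne_finset_zero (s := {0}) fun n hn => ?_
    simp [Finset.notMem_singleton.1 hn]
  · rw [tsum_eq_single 0 fun n hn => by simp [hn]]
    simp

/-- Weak continuity along the positive half of a ray extends to the whole line. -/
theorem continuous_inner_aut_line {H : Type*} [NormedAddCommGroup H] [InnerProductSpace ℂ H]
    [CompleteSpace H] {α : E0Semigroup P H} {β : E d → ((H →L[ℂ] H) ≃⋆ₐ[ℂ] (H →L[ℂ] H))}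
    (hβ : ∀ x y, β (x + y) = β x * β y) (hα : ∀ (x : P) (T : H →L[ℂ] H), α.toFun x T = β x T)
    {e : E d} (he : e ∈ P) (T : H →L[ℂ] H) (ζ η : H) :
    Continuous fun t : ℝ => ⟪ζ, β (t • e) T η⟫_ℂ := by
  rw [continuous_iff_continuousAt]
  intro t₀
  -- The shift by `n` brings a neighbourhood of `t₀` into the positive half-line, where `α` is
  -- available. Undoing it is conjugation by a fixed unitary, absorbed into `ζ` and `η`; the `max`
  -- only keeps `p` in the cone for all `t`.
  set n : ℝ := |t₀| + 1
  obtain ⟨w, hw⟩ := exists_unitary_conj (β (-n • e))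
  let p : ℝ → P := fun t => ⟨max (t + n) 0 • e, P.smul_mem (le_max_right _ _) he⟩
  have hp : Continuous p := Continuous.subtype_mk (by fun_prop) _
  have h1 : Continuous fun t => ⟪(star (w : H →L[ℂ] H)) ζ,
      α.toFun (p t) T ((star (w : H →L[ℂ] H)) η)⟫_ℂ :=
    (α.continuous' _ (isNormalFunctional_inner _ _) T).comp hp
  refine h1.continuousAt.congr ?_
  have hn : -n < t₀ := by
    have := neg_abs_le t₀
    simp only [n]
    linarith
  filter_upwards [lt_mem_nhds hn] with t ht
  have h2 : t • e = -n • e + (p t : E d) := by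
    change t • e = -n • e + max (t + n) 0 • e
    rw [max_eq_left (by linarith), ← add_smul]
    ring_nf
  rw [h2, hβ, hw, hα, ContinuousLinearMap.star_eq_adjoint, ContinuousLinearMap.adjoint_inner_left,
    ← ContinuousLinearMap.star_eq_adjoint]
  rfl

/-- A spanning cone contains a basis. -/
theorem exists_basis_mem (hspanning : ∀ z : E d, ∃ x ∈ P, ∃ y ∈ P, z = x - y) :
    ∃ (ι : Type) (_ : Finite ι) (b : Module.Basis ι ℝ (E d)), ∀ i, b i ∈ P := by
  have hs : ⊤ ≤ Submodule.span ℝ (P : Set (E d)) := by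
    intro z _
    obtain ⟨x, hx, y, hy, rfl⟩ := hspanning z
    exact Submodule.sub_mem _ (Submodule.subset_span hx) (Submodule.subset_span hy)
  exact ⟨_, Module.Finite.finite_basis (Module.Basis.ofSpan hs), Module.Basis.ofSpan hs,
    fun i => Module.Basis.ofSpan_subset hs ⟨i, rfl⟩⟩

/-- Changing the phases of a projective representation changes its multiplier by a symmetric form. -/
theorem exists_projective_representation_matrixForm {H : Type*} [NormedAddCommGroup H]
    [InnerProductSpace ℂ H] [CompleteSpace H] {V : E d → unitary (H →L[ℂ] H)}
    {B : E d →ₗ[ℝ] E d →ₗ[ℝ] ℝ} (hVc : ∀ η : H, Continuous fun x => (V x : H →L[ℂ] H) η)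
    (hV : ∀ x y, V x * V y = scalarUnitary H (Circle.exp (B x y)) * V (x + y)) :
    ∃ (A : StrictUpper d) (U : E d → unitary (H →L[ℂ] H)),
      (∀ η : H, Continuous fun x => (U x : H →L[ℂ] H) η) ∧
      (∀ x, Unitary.conjStarAlgAut ℂ (H →L[ℂ] H) (U x) =
        Unitary.conjStarAlgAut ℂ (H →L[ℂ] H) (V x)) ∧
      ∀ x y, U x * U y = scalarUnitary H (Circle.exp (matrixForm A x y)) * U (x + y) := by
  obtain ⟨A, hA⟩ := exists_strictUpper_sub_symm B
  set D : E d →ₗ[ℝ] E d →ₗ[ℝ] ℝ := B - matrixForm A with hD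
  have hDc : Continuous fun x => Circle.exp (D x x / 2) := by
    have h1 : Continuous fun x => D x x := by
      have h2 : Continuous fun x => ∑ i, x i * D (EuclideanSpace.single i 1) x := by
        refine continuous_finsetSum _ fun i _ => ?_
        have h3 : Continuous (D (EuclideanSpace.single i 1)) :=
          LinearMap.continuous_of_finiteDimensional _
        fun_prop
      refine h2.congr fun x => ?_
      have h4 := congrArg (fun z => D z x) ((EuclideanSpace.basisFun (Fin d) ℝ).sum_repr x)
      simpa only [map_sum, map_smul, LinearMap.sum_apply, LinearMap.smul_apply, smul_eq_mul,
        EuclideanSpace.basisFun_repr, EuclideanSpace.basisFun_apply] using h4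
    exact Circle.exp.continuous.comp (h1.div_const 2)
  -- As `D` is symmetric, D(x + y, x + y)/2 exceeds D(x, x)/2 + D(y, y)/2 by D(x, y), so this phase
  -- removes `D` from the multiplier.
  refine ⟨A, fun x => scalarUnitary H (Circle.exp (D x x / 2)) * V x,
    continuous_unitary_mul (continuous_scalarUnitary hDc) hVc, fun x => ?_, fun x y => ?_⟩
  · rw [map_mul, conj_scalarUnitary, one_mul]
  · have hsymm : D x y = D y x := hA x y
    have hB : B x y = D x y + matrixForm A x y := by
      rw [hD, LinearMap.sub_apply, LinearMap.sub_apply, sub_add_cancel]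
    have h1 : D y y / 2 + (D x x / 2 + B x y) = matrixForm A x y + D (x + y) (x + y) / 2 := by
      rw [hB]
      simp only [map_add, LinearMap.add_apply, ← hsymm]
      ring
    simp only
    rw [scalarUnitary_left_comm, mul_assoc, hV]
    simp only [← mul_assoc, ← map_mul, ← Circle.exp_add]
    rw [h1]

/-- The quotient of two projective representations with the same multiplier satisfies the cocycle
identity, because the multipliers cancel. -/
theorem cocycleConjugate_of_multiplier {A : StrictUpper d} {α : E0Semigroup P (L2 d)}
    {U : E d → unitary (L2 d →L[ℂ] L2 d)}
    (hUc : ∀ η : L2 d, Continuous fun x => (U x : L2 d →L[ℂ] L2 d) η)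
    (hα : ∀ (x : P) T, α.toFun x T = Unitary.conjStarAlgAut ℂ (L2 d →L[ℂ] L2 d) (U x) T)
    (hU : ∀ x y, U x * U y =
      scalarUnitary (L2 d) (Circle.exp (matrixForm A x y)) * U (x + y)) :
    CocycleConjugate α (twistedE0 P A) := by
  refine ⟨LinearIsometryEquiv.refl ℂ (L2 d),
    fun x => U x * (twistedTranslation A (x : E d))⁻¹, ⟨?_, fun x y => ?_⟩, fun x T => ?_⟩
  · exact continuous_unitary_mul (fun η => (hUc η).comp continuous_subtype_val)
      (continuous_unitary_star (W := fun x : P => twistedTranslation A (x : E d)) fun η =>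
        (continuous_twistedTranslation A η).comp continuous_subtype_val)
  · have h1 : U x * (twistedTranslation A (x : E d))⁻¹ * (twistedTranslation A (x : E d) *
        (U y * (twistedTranslation A (y : E d))⁻¹) * (twistedTranslation A (x : E d))⁻¹) =
        U (x + y : E d) * (twistedTranslation A (x + y : E d))⁻¹ := by
      have h2 : U x * U y * (twistedTranslation A (x : E d) * twistedTranslation A (y : E d))⁻¹ =
          U (x + y : E d) * (twistedTranslation A (x + y : E d))⁻¹ := by
        rw [hU, twistedTranslation_mul_unitary, scalarUnitary_mul_mul_inv]
      rw [← h2]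
      group
    exact congrArg Subtype.val h1
  · change α.toFun x T = Unitary.conjStarAlgAut ℂ (L2 d →L[ℂ] L2 d)
      (U x * (twistedTranslation A (x : E d))⁻¹)
      (Unitary.conjStarAlgAut ℂ (L2 d →L[ℂ] L2 d) (twistedTranslation A (x : E d)) T)
    rw [hα, ← Unitary.conjStarAlgAut_mul_apply, inv_mul_cancel_right]

/-- No continuity of the extension `β` is given. Choosing the basis inside `P` lets it be inherited
from `α` along each basis vector, which is all that the lifting to unitaries needs. -/
theorem twistedClass_surjective (hspanning : ∀ z : E d, ∃ x ∈ P, ∃ y ∈ P, z = x - y) :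
    Function.Surjective (twistedClass P) := by
  intro q
  induction q using Quotient.inductionOn with
  | h α =>
    obtain ⟨α, β, -, hβ, hα⟩ := α
    replace hβ : ∀ x y, β (x + y) = β x * β y := fun x y => StarAlgEquiv.ext (hβ x y)
    obtain ⟨ι, _, b, hb⟩ := exists_basis_mem hspanning
    obtain ⟨V, B, hVc, hVβ, hV⟩ := exists_projective_representation b hβ
      fun i => continuous_inner_aut_line hβ hα (hb i)
    obtain ⟨A, U, hUc, hUV, hU⟩ := exists_projective_representation_matrixForm hVc hV
    refine ⟨A, Quotient.sound (CocycleConjugate.symm (cocycleConjugate_of_multiplier hUc ?_ hU))⟩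
    intro x T
    rw [hα, hVβ, hUV]

end Surjective

end ConeE0

end

theorem mainTheorem12 (d : ℕ) (P : PointedCone ℝ (EuclideanSpace ℝ (Fin d)))
    (hclosed : IsClosed (P : Set (EuclideanSpace ℝ (Fin d))))
    (hspanning : ∀ z : EuclideanSpace ℝ (Fin d), ∃ x ∈ P, ∃ y ∈ P, z = x - y)
    (hpointed : ∀ x : EuclideanSpace ℝ (Fin d), x ∈ P → -x ∈ P → x = 0) :
    Function.Bijective
      (fun A : ConeE0.StrictUpper d => ConeE0.twistedClass P A) :=
  ⟨ConeE0.twistedClass_injective hspanning, ConeE0.twistedClass_surjective hspanning⟩
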